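/- Let $k$ be a field, let $n\ge 0$, and let $X=\{x_1<x_2<\cdots<x_n\}$ be a finite ordered set. Let $\Re_0$ be a set of binomial relations of skew-polynomial type in the free associative algebra $k\langle X\rangle$; that is, $$\Re_0=\{\,x_jx_i-c_{ij}\,x_{i'}x_{j'} \mid 1\le i<j\le n\,\}$$ consists of exactly one relation for each pair $i<j$ (where $c_{ij}\in k$ and the indices $i',j'$ depend on $(i,j)$), such that 1. each monomial $xy$ with $x,y\in X$, $x\neq y$, occurs in exactly one relation of $\Re_0$, and no monomial $xx$ occurs in a relation of $\Re_0$; 2. $c_{ij}\ne 0$ for all $i<j$; 3. $j>i'$ and $i'<j'$ for all $i<j$. (Thus $A_0=k\langle X\rangle/(\Re_0)$ is an algebra with binomial relations of skew-polynomial type.) Let $V$ be a $k$-vector space with basis $x_1,\dots,x_n$, and let $R=R(\Re_0)$ be the linear automorphism of $V\otimes V$ given by $$R(x_j\otimes x_i)=c_{ij}\,x_{i'}\otimes x_{j'},\qquad R(x_{i'}\otimes x_{j'})=c_{ij}^{-1}\,x_j\otimes x_i\quad(1\le i<j\le n),\qquad R(x_i\otimes x_i)=x_i\otimes x_i\quad(1\le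 i\le n).$$ Then $R$ is a solution of the (classical) Yang–Baxter equation $$(R\otimes \mathrm{id}_V)(\mathrm{id}_V\otimes R)(R\otimes \mathrm{id}_V)=(\mathrm{id}_V\otimes R)(R\otimes \mathrm{id}_V)(\mathrm{id}_V\otimes R)$$ in the automorphism group of $V\otimes V\otimes V$ if and only if $\Re_0$ is a Gröbner basis of the two-sided ideal $(\Re_0)$ of $k\langle X\rangle$ with respect to the degree-lexicographic order on words in $X$ induced by $x_1<\cdots<x_n$ (that is, the highest word of every nonzero element of $(\Re_0)$ contains the highest word of some element of $\Re_0$ as a contiguous subword). -/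

import Mathlib

open scoped TensorProduct

/-! ### The Yang-Baxter equation -/

section YangBaxter

variable {k V : Type*} [Field k] [AddCommGroup V] [Module k V]

/-- `R ⊗ id_V`, as an automorphism of `V ⊗ V ⊗ V = (V ⊗ V) ⊗ V`. -/
noncomputable def actLeft (R : (V ⊗[k] V) ≃ₗ[k] (V ⊗[k] V)) :
    ((V ⊗[k] V) ⊗[k] V) ≃ₗ[k] ((V ⊗[k] V) ⊗[k] V) :=
  TensorProduct.congr R (LinearEquiv.refl k V)

/-- `id_V ⊗ R`, as an automorphism of `V ⊗ V ⊗ V = (V ⊗ V) ⊗ V`. -/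
noncomputable def actRight (R : (V ⊗[k] V) ≃ₗ[k] (V ⊗[k] V)) :
    ((V ⊗[k] V) ⊗[k] V) ≃ₗ[k] ((V ⊗[k] V) ⊗[k] V) :=
  (TensorProduct.assoc k V V V).trans
    ((TensorProduct.congr (LinearEquiv.refl k V) R).trans (TensorProduct.assoc k V V V).symm)

/-- `R` is a solution of the (classical) Yang-Baxter equation:
`(R ⊗ id)(id ⊗ R)(R ⊗ id) = (id ⊗ R)(R ⊗ id)(id ⊗ R)` in the automorphism group of
`V ⊗ V ⊗ V`. -/
def IsYangBaxterSolution (R : (V ⊗[k] V) ≃ₗ[k] (V ⊗[k] V)) : Prop :=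
  actLeft R * actRight R * actLeft R = actRight R * actLeft R * actRight R

end YangBaxter

/-! ### Groebner bases in the free associative algebra -/

section Groebner

variable {k X : Type*} [Field k]

/-- The monomials (words in `X`) that occur in `f` with a nonzero coefficient. -/
def wordSupport (f : FreeAlgebra k X) : Set (List X) :=
  {w | (FreeAlgebra.equivMonoidAlgebraFreeMonoid f).coeff (FreeMonoid.ofList w) ≠ 0}

/-- `w` is the highest monomial of `f` with respect to the degree-lexicographic order on words
induced by the order of `X`. -/
def IsLeadingWord [LinearOrder X] (f : FreeAlgebra k X) (w : List X) : Prop :=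
  w ∈ wordSupport f ∧ ∀ v ∈ wordSupport f, v ≠ w → List.Shortlex (· < ·) v w

/-- `F` is a Groebner basis of the two-sided ideal `I` with respect to the degree-lexicographic
order: `F ⊆ I`, and the highest monomial of every nonzero element of `I` contains the highest
monomial of some element of `F` as a (contiguous) subword. -/
def IsGroebnerBasis [LinearOrder X] (F : Set (FreeAlgebra k X))
    (I : TwoSidedIdeal (FreeAlgebra k X)) : Prop :=
  (∀ g ∈ F, g ∈ I) ∧
    ∀ f ∈ I, f ≠ 0 → ∃ u, IsLeadingWord f u ∧ ∃ g ∈ F, ∃ v, IsLeadingWord g v ∧ v <:+: u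

end Groebner

/-! ### Binomial relations of skew-polynomial type -/

/-- The pairs `(j, i)` with `i < j`, indexing the monomials `x_j x_i` with `i < j`. -/
abbrev DescPair (n : ℕ) : Type := {p : Fin n × Fin n // p.2 < p.1}

/-- A set of `n(n-1)/2` binomial relations of skew-polynomial type in `x_1 < ⋯ < x_n`: one relation
`x_j x_i = c_{ij} x_{i'} x_{j'}` for each pair `i < j`. Here `coeff (j, i) = c_{ij}` and
`rhs (j, i) = (i', j')`. -/
structure SkewPolynomialRelations (k : Type*) [Field k] (n : ℕ) where
  /-- the coefficients `c_{ij}` -/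
  coeff : DescPair n → k
  /-- the pairs `(i', j')` -/
  rhs : DescPair n → Fin n × Fin n
  /-- each monomial `xy` with `x ≠ y` occurs in exactly one relation -/
  occurs_once : ∀ x y : Fin n, x ≠ y → ∃! p : DescPair n, p.1 = (x, y) ∨ rhs p = (x, y)
  /-- no monomial `xx` occurs in a relation -/
  square_free : ∀ (x : Fin n) (p : DescPair n), p.1 ≠ (x, x) ∧ rhs p ≠ (x, x)
  /-- `c_{ij} ≠ 0` -/
  coeff_ne_zero : ∀ p, coeff p ≠ 0
  /-- `j > i'` -/
  rhs_fst_lt : ∀ p, (rhs p).1 < p.1.1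
  /-- `i' < j'` -/
  rhs_lt : ∀ p, (rhs p).1 < (rhs p).2

namespace SkewPolynomialRelations

variable {k : Type*} [Field k] {n : ℕ} (S : SkewPolynomialRelations k n)

/-- The defining relation `x_j x_i - c_{ij} x_{i'} x_{j'}` as an element of `k⟨x_1, …, x_n⟩`. -/
noncomputable def relation (p : DescPair n) : FreeAlgebra k (Fin n) :=
  FreeAlgebra.ι k p.1.1 * FreeAlgebra.ι k p.1.2
    - S.coeff p • (FreeAlgebra.ι k (S.rhs p).1 * FreeAlgebra.ι k (S.rhs p).2)

/-- The set `ℜ₀` of all defining relations. -/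
def relations : Set (FreeAlgebra k (Fin n)) := Set.range S.relation

/-- The two-sided ideal `(ℜ₀)`. -/
def ideal : TwoSidedIdeal (FreeAlgebra k (Fin n)) := TwoSidedIdeal.span S.relations

/-- The algebra `A₀ = k⟨x_1, …, x_n⟩ / (ℜ₀)`. -/
abbrev algebra : Type _ := S.ideal.ringCon.Quotient

theorem exists_rhs_eq {x y : Fin n} (h : x < y) : ∃ p : DescPair n, S.rhs p = (x, y) := by
  obtain ⟨p, hp | hp, -⟩ := S.occurs_once x y h.ne
  · have := p.2
    rw [hp] at this
    exact absurd this h.not_gt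
  · exact ⟨p, hp⟩

/-- For `i' < j'`, the pair `(j, i)` whose relation has right-hand side `c_{ij} x_{i'} x_{j'}`. -/
noncomputable def lhs {x y : Fin n} (h : x < y) : DescPair n := (S.exists_rhs_eq h).choose

theorem rhs_lhs {x y : Fin n} (h : x < y) : S.rhs (S.lhs h) = (x, y) :=
  (S.exists_rhs_eq h).choose_spec

theorem lhs_eq {x y : Fin n} (h : x < y) (p : DescPair n) (hp : S.rhs p = (x, y)) :
    S.lhs h = p :=
  (S.occurs_once x y h.ne).unique (Or.inr (S.rhs_lhs h)) (Or.inr hp)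

variable {V : Type*} [AddCommGroup V] [Module k V] (b : Module.Basis (Fin n) k V)

/-- The value of `R(ℜ₀)` on the basis vector `x_a ⊗ x_c` of `V ⊗ V`. -/
noncomputable def autoFun (q : Fin n × Fin n) : V ⊗[k] V :=
  if h : q.2 < q.1 then S.coeff ⟨q, h⟩ • (b (S.rhs ⟨q, h⟩).1 ⊗ₜ[k] b (S.rhs ⟨q, h⟩).2)
  else if h' : q.1 < q.2 then
    (S.coeff (S.lhs h'))⁻¹ • (b (S.lhs h').1.1 ⊗ₜ[k] b (S.lhs h').1.2)
  else b q.1 ⊗ₜ[k] b q.2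

/-- The linear map `R(ℜ₀) : V ⊗ V → V ⊗ V`. -/
noncomputable def autoMap : (V ⊗[k] V) →ₗ[k] (V ⊗[k] V) :=
  (b.tensorProduct b).constr k (S.autoFun b)

theorem autoMap_tmul (x y : Fin n) : S.autoMap b (b x ⊗ₜ[k] b y) = S.autoFun b (x, y) := by
  rw [autoMap, ← Module.Basis.tensorProduct_apply, Module.Basis.constr_basis]

theorem autoMap_desc (p : DescPair n) :
    S.autoMap b (b p.1.1 ⊗ₜ[k] b p.1.2)
      = S.coeff p • (b (S.rhs p).1 ⊗ₜ[k] b (S.rhs p).2) := by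
  rw [autoMap_tmul, autoFun, dif_pos p.2]

theorem autoMap_asc (p : DescPair n) :
    S.autoMap b (b (S.rhs p).1 ⊗ₜ[k] b (S.rhs p).2)
      = (S.coeff p)⁻¹ • (b p.1.1 ⊗ₜ[k] b p.1.2) := by
  have h := S.rhs_lt p
  rw [autoMap_tmul, autoFun, dif_neg h.not_gt, dif_pos h, S.lhs_eq h p rfl]

theorem autoMap_diag (x : Fin n) : S.autoMap b (b x ⊗ₜ[k] b x) = b x ⊗ₜ[k] b x := by
  rw [autoMap_tmul, autoFun, dif_neg (lt_irrefl _), dif_neg (lt_irrefl _)]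

theorem autoMap_involutive : Function.Involutive (S.autoMap b) := by
  have h : S.autoMap b ∘ₗ S.autoMap b = LinearMap.id := by
    refine (b.tensorProduct b).ext fun q => ?_
    obtain ⟨x, y⟩ := q
    rw [Module.Basis.tensorProduct_apply, LinearMap.comp_apply, LinearMap.id_apply]
    rcases lt_trichotomy x y with hxy | rfl | hxy
    · have hp := S.rhs_lhs hxy
      have h1 := S.autoMap_asc b (S.lhs hxy)
      rw [hp] at h1
      rw [h1, map_smul, S.autoMap_desc b (S.lhs hxy), hp, smul_smul,
        inv_mul_cancel₀ (S.coeff_ne_zero _), one_smul]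
    · rw [autoMap_diag, autoMap_diag]
    · have h1 := S.autoMap_desc b ⟨(x, y), hxy⟩
      rw [h1, map_smul, S.autoMap_asc b, smul_smul, mul_inv_cancel₀ (S.coeff_ne_zero _), one_smul]
  exact fun v => LinearMap.congr_fun h v

/-- The linear automorphism `R(ℜ₀)` of `V ⊗ V`, where `V` has basis `x_1, …, x_n`:
`R(x_j ⊗ x_i) = c_{ij} x_{i'} ⊗ x_{j'}` and `R(x_{i'} ⊗ x_{j'}) = c_{ij}⁻¹ x_j ⊗ x_i` for `i < j`,
and `R(x_i ⊗ x_i) = x_i ⊗ x_i`. -/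
noncomputable def automorphism : (V ⊗[k] V) ≃ₗ[k] (V ⊗[k] V) :=
  LinearEquiv.ofInvolutive (S.autoMap b) (S.autoMap_involutive b)

end SkewPolynomialRelations

/-!
`R` permutes the words of length two up to scalars, so on words of length three the Yang-Baxter
equation is the braid relation between two involutions `R ⊗ id` and `id ⊗ R` of the scalar multiples
of words. It is equivalent to each word of length three reducing to a unique scalar multiple of a
weakly increasing word.

If the braid relation holds, the orbit of a weakly increasing word has at most `6`, `3` or `1`
elements, according to whether its letters are distinct, two of them agree or all agree. These
bounds add up to the total number of words, as the commutative polynomial algebra shows, so no word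
can occur twice in the orbits. Conversely, if normal forms exist, then every orbit contains as many
descents as ascents. Weighting this balance, for words with one repeated letter, by an embedding of
the letters into `ℤ` shows that `R` is nondegenerate, hence that the orbits have at least `6`, `3`
or `1` elements; by the same count equality holds, and orbits of these sizes satisfy the braid
relation.

On the Gröbner side, the leading words of the relations are the descents `x_j x_i`, which overlap
only in words of length three, so the diamond lemma reduces the Gröbner property to the uniqueness
of normal forms of such words.
-/

theorem sum_eq_zero_of_involutive_neg {ι : Type*} {s : Finset ι} {g : ι → ι}
    (hg : Function.Involutive g) (hs : ∀ i ∈ s, g i ∈ s) {f : ι → ℤ}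
    (hf : ∀ i ∈ s, f (g i) = -f i) : ∑ i ∈ s, f i = 0 := by
  refine Finset.sum_involution (fun i _ => g i) (fun i hi => by rw [hf i hi, add_neg_cancel])
    (fun i hi hne hfix => hne ?_) hs fun i _ => hg i
  have := hf i hi
  rw [hfix] at this
  omega

/-! ### Words of length three -/

/-- `1` for a descent, `-1` for an ascent, `0` on the diagonal. -/
def descentSign {X : Type*} [LinearOrder X] (q : X × X) : ℤ :=
  (if q.2 < q.1 then 1 else 0) - if q.1 < q.2 then 1 else 0

section DescentSign

variable {X : Type*} [LinearOrder X]

theorem descentSign_of_gt {x y : X} (h : y < x) : descentSign (x, y) = 1 := by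
  simp [descentSign, h, h.not_gt]

theorem descentSign_of_lt {x y : X} (h : x < y) : descentSign (x, y) = -1 := by
  simp [descentSign, h, h.not_gt]

@[simp]
theorem descentSign_self (x : X) : descentSign (x, x) = 0 := by
  simp [descentSign]

theorem descentSign_swap (x y : X) : descentSign (y, x) = -descentSign (x, y) := by
  simp [descentSign]

end DescentSign

/-- Words of length three. -/
abbrev Triple (X : Type*) : Type _ := X × X × X

namespace Triple

variable {X : Type*} [LinearOrder X]

/-- A word is normal if its letters increase weakly, i.e. if no relation applies to it. -/
def IsNormal (w : Triple X) : Prop := w.1 ≤ w.2.1 ∧ w.2.1 ≤ w.2.2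

instance : DecidablePred (IsNormal (X := X)) := fun w =>
  inferInstanceAs (Decidable (w.1 ≤ w.2.1 ∧ w.2.1 ≤ w.2.2))

/-- The number of descents minus the number of ascents. -/
def height (w : Triple X) : ℤ := descentSign (w.1, w.2.1) + descentSign w.2

/-- The reversed word. -/
def rev (w : Triple X) : Triple X := (w.2.2, w.2.1, w.1)

theorem height_rev (w : Triple X) : height (rev w) = -height w := by
  rw [height, height, rev, descentSign_swap w.2.1 w.2.2, descentSign_swap w.1 w.2.1]
  ring

theorem isNormal_of_height_neg {w : Triple X} (h : height w < 0) : IsNormal w := by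
  simp only [height, descentSign] at h
  constructor <;> by_contra! <;> grind

theorem height_eq_neg_two_iff {w : Triple X} : height w = -2 ↔ w.1 < w.2.1 ∧ w.2.1 < w.2.2 := by
  simp only [height, descentSign]
  grind

theorem height_eq_two_iff {w : Triple X} : height w = 2 ↔ w.2.1 < w.1 ∧ w.2.2 < w.2.1 := by
  simp only [height, descentSign]
  grind

end Triple

/-! ### Involutions of skew-polynomial type -/

/-- The combinatorial part of `R(ℜ₀)`: an involution of `X × X` which fixes the diagonal, exchanges
descents and ascents, and lowers the first letter of every descent. -/
structure SkewInvolution (X : Type*) [LinearOrder X] where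
  /-- the underlying map -/
  map : X × X → X × X
  map_map : ∀ q, map (map q) = q
  map_diag : ∀ x, map (x, x) = (x, x)
  map_fst_lt_snd : ∀ {q : X × X}, q.2 < q.1 → (map q).1 < (map q).2
  map_snd_lt_fst : ∀ {q : X × X}, q.1 < q.2 → (map q).2 < (map q).1
  map_fst_lt : ∀ {q : X × X}, q.2 < q.1 → (map q).1 < q.1

namespace SkewInvolution

variable {X : Type*} [LinearOrder X] (r : SkewInvolution X)

theorem map_injective : Function.Injective r.map :=
  (show Function.Involutive r.map from r.map_map).injective

theorem descentSign_map (q : X × X) : descentSign (r.map q) = -descentSign q := by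
  obtain ⟨x, y⟩ := q
  rcases lt_trichotomy x y with h | rfl | h
  · rw [descentSign_of_lt h, ← Prod.mk.eta (p := r.map (x, y)),
      descentSign_of_gt (r.map_snd_lt_fst h), neg_neg]
  · rw [r.map_diag, descentSign_self, neg_zero]
  · rw [descentSign_of_gt h, ← Prod.mk.eta (p := r.map (x, y)),
      descentSign_of_lt (r.map_fst_lt_snd h)]

theorem lt_map_fst {q : X × X} (h : q.1 < q.2) : q.1 < (r.map q).1 := by
  simpa only [r.map_map] using r.map_fst_lt (r.map_snd_lt_fst h)

theorem map_fst_lt_iff {x y : X} : (r.map (x, y)).1 < x ↔ y < x := by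
  refine ⟨fun h => ?_, r.map_fst_lt (q := (x, y))⟩
  by_contra! hxy
  rcases hxy.eq_or_lt with rfl | hxy
  · simp [r.map_diag] at h
  · exact h.not_gt (r.lt_map_fst (q := (x, y)) hxy)

theorem lt_map_fst_iff {x y : X} : x < (r.map (x, y)).1 ↔ x < y := by
  refine ⟨fun h => ?_, r.lt_map_fst (q := (x, y))⟩
  by_contra! hxy
  rcases hxy.eq_or_lt with rfl | hxy
  · simp [r.map_diag] at h
  · exact h.not_gt (r.map_fst_lt (q := (x, y)) hxy)

theorem map_fst_eq_iff {x y : X} : (r.map (x, y)).1 = x ↔ x = y := by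
  rw [eq_iff_le_not_lt, ← not_lt, r.lt_map_fst_iff, r.map_fst_lt_iff, not_lt, not_lt,
    le_antisymm_iff, and_comm]

theorem sum_comp_map [Fintype X] (f : X × X → ℤ) : ∑ q, f (r.map q) = ∑ q, f q :=
  Equiv.sum_comp (Function.Involutive.toPerm r.map r.map_map) f

/-- The involution applied to the first two letters. -/
def left (w : Triple X) : Triple X := ((r.map (w.1, w.2.1)).1, (r.map (w.1, w.2.1)).2, w.2.2)

/-- The involution applied to the last two letters. -/
def right (w : Triple X) : Triple X := (w.1, r.map w.2)

theorem left_involutive : Function.Involutive r.left := fun w => by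
  simp only [left, Prod.mk.eta, r.map_map]

theorem right_involutive : Function.Involutive r.right := fun w => by
  simp only [right, Prod.mk.eta, r.map_map]

theorem left_eq_self_iff {w : Triple X} : r.left w = w ↔ w.1 = w.2.1 := by
  refine ⟨fun h => r.map_fst_eq_iff.1 (congrArg Prod.fst h), fun h => ?_⟩
  obtain ⟨x, y, z⟩ := w
  obtain rfl : x = y := h
  simp only [left, r.map_diag]

theorem right_eq_self_iff {w : Triple X} : r.right w = w ↔ w.2.1 = w.2.2 := by
  refine ⟨fun h => r.map_fst_eq_iff.1 (congrArg (·.2.1) h), fun h => ?_⟩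
  obtain ⟨x, y, z⟩ := w
  obtain rfl : y = z := h
  simp only [right, r.map_diag]

theorem triple_induction [WellFoundedLT X] {P : Triple X → Prop}
    (normal : ∀ w, w.IsNormal → P w)
    (left : ∀ w : Triple X, w.2.1 < w.1 → P (r.left w) → P w)
    (right : ∀ w : Triple X, w.2.2 < w.2.1 → P (r.right w) → P w) (w : Triple X) : P w := by
  induction hm : toLex (w.1, w.2.1) using WellFoundedLT.induction generalizing w with
  | ind m ih =>
    subst hm
    by_cases hleft : w.2.1 < w.1
    · refine left w hleft (ih _ ?_ _ rfl)
      exact Prod.Lex.toLex_lt_toLex.2 (.inl (r.map_fst_lt hleft))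
    by_cases hright : w.2.2 < w.2.1
    · refine right w hright (ih _ ?_ _ rfl)
      exact Prod.Lex.toLex_lt_toLex.2 (.inr ⟨rfl, r.map_fst_lt hright⟩)
    · exact normal w ⟨not_lt.1 hleft, not_lt.1 hright⟩

/-- Pairing each descent `q` with the ascent `r q` turns the sum in the hypothesis into the sum of
the nonnegative numbers `(f q - f (r q)) * g q` over the descents. -/
theorem sub_mul_eq_zero_of_sum_eq_zero [Fintype X] {f g : X × X → ℤ}
    (hsum : ∑ q, descentSign q * f q * g q = 0) (hg : ∀ q, g (r.map q) = g q)
    (hpos : ∀ q, q.2 < q.1 → 0 ≤ (f q - f (r.map q)) * g q) {q : X × X} (hq : q.2 < q.1) :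
    (f q - f (r.map q)) * g q = 0 := by
  have hsum' : ∑ q, descentSign q * f (r.map q) * g q = 0 := by
    rw [← r.sum_comp_map]
    simp only [r.map_map, hg, r.descentSign_map, neg_mul, Finset.sum_neg_distrib, hsum, neg_zero]
  have hsub : ∑ q, descentSign q * ((f q - f (r.map q)) * g q) = 0 := by
    rw [← sub_eq_zero.2 (hsum.trans hsum'.symm), ← Finset.sum_sub_distrib]
    exact Finset.sum_congr rfl fun q _ => by ring
  have hnonneg : ∀ q, 0 ≤ descentSign q * ((f q - f (r.map q)) * g q) := by
    rintro ⟨x, y⟩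
    rcases lt_trichotomy x y with h | rfl | h
    · have := hpos _ (r.map_snd_lt_fst (q := (x, y)) h)
      rw [r.map_map, hg] at this
      rw [descentSign_of_lt h]
      linarith
    · simp
    · rw [descentSign_of_gt h, one_mul]
      exact hpos (x, y) h
  have hzero := (Finset.sum_eq_zero_iff_of_nonneg fun q _ => hnonneg q).1 hsub q (Finset.mem_univ q)
  rwa [← Prod.mk.eta (p := q), descentSign_of_gt hq, one_mul] at hzero

end SkewInvolution

/-! ### Hexagons -/

section Hexagon

variable {α : Type*} [DecidableEq α] {s t : α → α} {u : α} {Y : Finset α}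

/-- The elements reached from `u` by the involutions `s` and `t`, provided that `s` and `t` satisfy
the braid relation `s t s = t s t`. -/
def hexagon (s t : α → α) (u : α) : Finset α := {u, s u, t u, t (s u), s (t u), s (t (s u))}

theorem mem_hexagon {w : α} : w ∈ hexagon s t u ↔
    w = u ∨ w = s u ∨ w = t u ∨ w = t (s u) ∨ w = s (t u) ∨ w = s (t (s u)) := by
  simp only [hexagon, Finset.mem_insert, Finset.mem_singleton]

theorem self_mem_hexagon : u ∈ hexagon s t u := mem_hexagon.2 (.inl rfl)

theorem card_hexagon_le_six : (hexagon s t u).card ≤ 6 := Finset.card_le_six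

theorem image_hexagon {β : Type*} [DecidableEq β] {s' t' : β → β} {f : α → β}
    (hs : Function.Semiconj f s s') (ht : Function.Semiconj f t t') (u : α) :
    (hexagon s t u).image f = hexagon s' t' (f u) := by
  simp only [hexagon, Finset.image_insert, Finset.image_singleton, hs.eq, ht.eq]

theorem card_hexagon_le_three_of_left_fixed (hs : s u = u) : (hexagon s t u).card ≤ 3 := by
  refine (Finset.card_le_card fun w hw => ?_).trans (Finset.card_le_three (a := u) (b := t u)
    (c := s (t u)))
  rw [mem_hexagon, hs] at hw
  simp only [Finset.mem_insert, Finset.mem_singleton]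
  tauto

theorem card_hexagon_le_three_of_right_fixed (ht : t u = u)
    (braid : s (t (s u)) = t (s (t u))) : (hexagon s t u).card ≤ 3 := by
  refine (Finset.card_le_card fun w hw => ?_).trans (Finset.card_le_three (a := u) (b := s u)
    (c := t (s u)))
  rw [mem_hexagon, braid, ht] at hw
  simp only [Finset.mem_insert, Finset.mem_singleton]
  tauto

theorem card_hexagon_le_one (hs : s u = u) (ht : t u = u) : (hexagon s t u).card ≤ 1 :=
  Finset.card_le_one.2 fun a ha b hb => by simp_all [mem_hexagon]

theorem left_mem_hexagon (hs : Function.Involutive s) (ht : Function.Involutive t)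
    (braid : ∀ w, s (t (s w)) = t (s (t w))) {w : α} (hw : w ∈ hexagon s t u) :
    s w ∈ hexagon s t u := by
  rw [mem_hexagon] at hw ⊢
  grind [Function.Involutive]

theorem right_mem_hexagon (hs : Function.Involutive s) (ht : Function.Involutive t)
    (braid : ∀ w, s (t (s w)) = t (s (t w))) {w : α} (hw : w ∈ hexagon s t u) :
    t w ∈ hexagon s t u := by
  rw [mem_hexagon] at hw ⊢
  grind [Function.Involutive]

theorem hexagon_subset (hsY : ∀ w ∈ Y, s w ∈ Y) (htY : ∀ w ∈ Y, t w ∈ Y) (hu : u ∈ Y) :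
    hexagon s t u ⊆ Y := by
  intro w hw
  rcases mem_hexagon.1 hw with rfl | rfl | rfl | rfl | rfl | rfl <;> grind

theorem card_hexagon_eq_six (hs : Function.Involutive s) (ht : Function.Involutive t)
    (hsY : ∀ w ∈ Y, s w ∈ Y) (htY : ∀ w ∈ Y, t w ∈ Y) (hs_ne : ∀ w ∈ Y, s w ≠ w)
    (ht_ne : ∀ w ∈ Y, t w ≠ w) (hst_ne : ∀ w ∈ Y, s w ≠ t w)
    (hcomm_ne : ∀ w ∈ Y, s (t w) ≠ t (s w)) (hu : u ∈ Y) : (hexagon s t u).card = 6 := by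
  have hsu := hsY u hu
  have htu := htY u hu
  have htsu := htY _ hsu
  have : s (t u) ∈ Y ∧ s (t (s u)) ∈ Y := ⟨hsY _ htu, hsY _ htsu⟩
  unfold hexagon
  repeat rw [Finset.card_insert_of_notMem]
  · rw [Finset.card_singleton]
  all_goals simp only [Finset.mem_insert, Finset.mem_singleton]; grind [Function.Involutive]

omit [DecidableEq α] in
theorem six_le_card_of_involutive (hs : Function.Involutive s) (ht : Function.Involutive t)
    (hsY : ∀ w ∈ Y, s w ∈ Y) (htY : ∀ w ∈ Y, t w ∈ Y) (hs_ne : ∀ w ∈ Y, s w ≠ w)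
    (ht_ne : ∀ w ∈ Y, t w ≠ w) (hst_ne : ∀ w ∈ Y, s w ≠ t w)
    (hcomm_ne : ∀ w ∈ Y, s (t w) ≠ t (s w)) (hu : u ∈ Y) :
    6 ≤ Y.card ∧ (Y.card = 6 → ∀ w ∈ Y, s (t (s w)) = t (s (t w))) := by
  classical
  have hcard := fun {u} => card_hexagon_eq_six (u := u) hs ht hsY htY hs_ne ht_ne hst_ne hcomm_ne
  have hsub := fun {u} => hexagon_subset (u := u) hsY htY
  refine ⟨hcard hu ▸ Finset.card_le_card (hsub hu), fun h w hw => ?_⟩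
  have hmem := htY _ (hsY _ (htY _ hw))
  rw [← Finset.eq_of_subset_of_card_le (hsub hw) (by rw [h, hcard hw]), mem_hexagon] at hmem
  grind [Function.Involutive]

omit [DecidableEq α] in
theorem three_le_card_of_involutive (hs : Function.Involutive s) (ht : Function.Involutive t)
    (hsY : ∀ w ∈ Y, s w ∈ Y) (htY : ∀ w ∈ Y, t w ∈ Y) (hu : u ∈ Y) (hsu : s u = u)
    (htu : t u ≠ u) (hstu : s (t u) ≠ t u) :
    3 ≤ Y.card ∧ (Y.card = 3 → ∀ w ∈ Y, s (t (s w)) = t (s (t w))) := by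
  classical
  have htu_mem := htY u hu
  have hstu_mem := hsY _ htu_mem
  have hcard : ({u, t u, s (t u)} : Finset α).card = 3 :=
    Finset.card_eq_three.2 ⟨_, _, _, htu.symm, by grind [Function.Involutive], hstu.symm, rfl⟩
  have hsub : ({u, t u, s (t u)} : Finset α) ⊆ Y := by
    simp only [Finset.insert_subset_iff, Finset.singleton_subset_iff]
    exact ⟨hu, htu_mem, hstu_mem⟩
  refine ⟨hcard ▸ Finset.card_le_card hsub, fun h w hw => ?_⟩
  have hmem := htY _ hstu_mem
  rw [← Finset.eq_of_subset_of_card_le hsub (by omega)] at hmem hw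
  simp only [Finset.mem_insert, Finset.mem_singleton] at hmem hw
  grind [Function.Involutive]

end Hexagon

/-! ### Normal forms of words of length three -/

/-- A retraction of the words of length three onto the normal ones which is constant on the orbits
of `r × id` and `id × r`. -/
structure SkewInvolution.NormalForm {X : Type*} [LinearOrder X] (r : SkewInvolution X) where
  /-- the normal form of a word -/
  nf : Triple X → Triple X
  nf_left : ∀ w, nf (r.left w) = nf w
  nf_right : ∀ w, nf (r.right w) = nf w
  isNormal_nf : ∀ w, (nf w).IsNormal
  nf_eq_self : ∀ {w : Triple X}, w.IsNormal → nf w = w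

namespace SkewInvolution.NormalForm

open Triple

section Orbit

variable {X : Type*} [LinearOrder X] [Fintype X] {r : SkewInvolution X} (N : r.NormalForm)
  {u w : Triple X}

/-- The words with normal form `u`. -/
def orbit (u : Triple X) : Finset (Triple X) := {w | N.nf w = u}

theorem mem_orbit : w ∈ N.orbit u ↔ N.nf w = u := by simp [orbit]

theorem left_mem_orbit (h : w ∈ N.orbit u) : r.left w ∈ N.orbit u := by
  rwa [mem_orbit, N.nf_left, ← mem_orbit]

theorem right_mem_orbit (h : w ∈ N.orbit u) : r.right w ∈ N.orbit u := by
  rwa [mem_orbit, N.nf_right, ← mem_orbit]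

theorem self_mem_orbit (hu : u.IsNormal) : u ∈ N.orbit u := N.mem_orbit.2 (N.nf_eq_self hu)

theorem sum_height_orbit (u : Triple X) : ∑ w ∈ N.orbit u, height w = 0 := by
  have hleft : ∑ w ∈ N.orbit u, descentSign (w.1, w.2.1) = 0 :=
    sum_eq_zero_of_involutive_neg r.left_involutive (fun _ => N.left_mem_orbit)
      fun w _ => r.descentSign_map (w.1, w.2.1)
  have hright : ∑ w ∈ N.orbit u, descentSign w.2 = 0 :=
    sum_eq_zero_of_involutive_neg r.right_involutive (fun _ => N.right_mem_orbit)
      fun w _ => r.descentSign_map w.2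
  simp only [height, Finset.sum_add_distrib, hleft, hright, add_zero]

theorem height_nonneg_of_mem_erase (hw : w ∈ (N.orbit u).erase u) : 0 ≤ height w := by
  by_contra! h
  obtain ⟨hne, hmem⟩ := Finset.mem_erase.1 hw
  exact hne ((N.nf_eq_self (isNormal_of_height_neg h)).symm.trans (N.mem_orbit.1 hmem))

theorem sum_height_erase (hu : height u = -1) : ∑ w ∈ (N.orbit u).erase u, height w = 1 := by
  have hmem : u ∈ N.orbit u := N.self_mem_orbit (isNormal_of_height_neg (by omega))
  have := Finset.add_sum_erase _ height hmem
  rw [N.sum_height_orbit, hu] at this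
  omega

theorem height_le_one (hu : height u = -1) (hw : w ∈ N.orbit u) : height w ≤ 1 := by
  obtain rfl | hne := eq_or_ne w u
  · omega
  · rw [← N.sum_height_erase hu]
    exact Finset.single_le_sum (fun _ => N.height_nonneg_of_mem_erase)
      (Finset.mem_erase.2 ⟨hne, hw⟩)

theorem exists_height_eq_one (hu : height u = -1) : ∃ w ∈ N.orbit u, height w = 1 := by
  obtain ⟨w, hw, hpos⟩ : ∃ w ∈ (N.orbit u).erase u, 0 < height w := by
    by_contra! h
    have := Finset.sum_nonpos h
    rw [N.sum_height_erase hu] at this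
    omega
  have hmem := Finset.mem_of_mem_erase hw
  exact ⟨w, hmem, le_antisymm (N.height_le_one hu hmem) hpos⟩

omit [Fintype X] in
theorem height_nf_of_height_eq_one [Finite X] (hw : height w = 1) : height (N.nf w) = -1 := by
  cases nonempty_fintype X
  choose f hf using fun u : {u : Triple X // height u = -1} => N.exists_height_eq_one u.2
  -- As many words have height `1` as height `-1`, so `f` also exhausts the words of height `1`.
  let g : {u : Triple X // height u = -1} → {u : Triple X // height u = -1} := fun u =>
    ⟨rev (f u), by rw [height_rev, (hf u).2]⟩
  have hg : Function.Injective g := fun u v h => by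
    have hfuv : f u = f v := congrArg rev (congrArg Subtype.val h)
    exact Subtype.ext ((N.mem_orbit.1 (hf u).1).symm.trans (hfuv ▸ N.mem_orbit.1 (hf v).1))
  obtain ⟨u, hu⟩ := Finite.injective_iff_surjective.1 hg ⟨rev w, by rw [height_rev, hw]⟩
  obtain rfl : f u = w := congrArg rev (congrArg Subtype.val hu)
  rw [N.mem_orbit.1 (hf u).1, u.2]

/-- The words whose normal form has exactly one repeated letter. -/
def repeats : Finset (Triple X) := {w | height (N.nf w) = -1}

theorem mem_repeats : w ∈ N.repeats ↔ height (N.nf w) = -1 := by simp [repeats]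

theorem left_mem_repeats : r.left w ∈ N.repeats ↔ w ∈ N.repeats := by
  rw [mem_repeats, N.nf_left, mem_repeats]

theorem right_mem_repeats : r.right w ∈ N.repeats ↔ w ∈ N.repeats := by
  rw [mem_repeats, N.nf_right, mem_repeats]

theorem mem_repeats_of_height (h : height w = 1 ∨ height w = -1) : w ∈ N.repeats := by
  rcases h with h | h
  · exact N.mem_repeats.2 (N.height_nf_of_height_eq_one h)
  · rwa [mem_repeats, N.nf_eq_self (isNormal_of_height_neg (by omega))]

theorem mk_self_fst_mem_repeats {q : X × X} (h : q.1 ≠ q.2) : (q.1, q) ∈ N.repeats := by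
  refine N.mem_repeats_of_height ?_
  rcases h.lt_or_gt with h | h <;> simp [height, descentSign, h, h.not_gt]

theorem mk_self_snd_mem_repeats {q : X × X} (h : q.1 ≠ q.2) : (q.1, q.2, q.2) ∈ N.repeats := by
  refine N.mem_repeats_of_height ?_
  rcases h.lt_or_gt with h | h <;> simp [height, descentSign, h, h.not_gt]

theorem not_lt_lt_of_mem_repeats (h : w ∈ N.repeats) : ¬(w.1 < w.2.1 ∧ w.2.1 < w.2.2) := by
  rw [← height_eq_neg_two_iff]
  intro hw
  rw [mem_repeats, N.nf_eq_self (isNormal_of_height_neg (by omega)), hw] at h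
  omega

theorem not_gt_gt_of_mem_repeats (h : w ∈ N.repeats) : ¬(w.2.1 < w.1 ∧ w.2.2 < w.2.1) := by
  rw [← height_eq_two_iff]
  intro hw
  have := N.height_le_one (N.mem_repeats.1 h) (N.mem_orbit.2 rfl)
  omega

theorem indicator_repeats_height (w : Triple X) :
    (if w ∈ N.repeats then height w else 0) =
      (if w.1 = w.2.1 then descentSign w.2 else 0) +
        if w.2.1 = w.2.2 then descentSign (w.1, w.2.1) else 0 := by
  obtain ⟨x, y, z⟩ := w
  rcases eq_or_ne x y with rfl | hxy
  · rcases eq_or_ne x z with rfl | hxz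
    · simp [height]
    · simp [N.mk_self_fst_mem_repeats (q := (x, z)) hxz, height, hxz]
  rcases eq_or_ne y z with rfl | hyz
  · simp [N.mk_self_snd_mem_repeats (q := (x, y)) hxy, height, hxy]
  simp only [hxy, hyz, if_false, add_zero, ite_eq_right_iff]
  intro h
  have hasc := N.not_lt_lt_of_mem_repeats h
  have hdesc := N.not_gt_gt_of_mem_repeats h
  simp only [height, descentSign]
  grind

theorem sum_repeats_height_mul (φ : Triple X → ℤ) :
    ∑ w ∈ N.repeats, height w * φ w =
      ∑ q : X × X, descentSign q * (φ (q.1, q) + φ (q.1, q.2, q.2)) := by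
  have hfst : ∑ w : Triple X, (if w.1 = w.2.1 then descentSign w.2 else 0) * φ w =
      ∑ q : X × X, descentSign q * φ (q.1, q) := by
    simp only [Fintype.sum_prod_type_right, ite_mul, zero_mul, Finset.sum_ite_eq', Finset.mem_univ,
      if_true]
  have hsnd : ∑ w : Triple X, (if w.2.1 = w.2.2 then descentSign (w.1, w.2.1) else 0) * φ w =
      ∑ q : X × X, descentSign q * φ (q.1, q.2, q.2) := by
    simp only [Fintype.sum_prod_type, ite_mul, zero_mul, Finset.sum_ite_eq, Finset.mem_univ,
      if_true]
  calc ∑ w ∈ N.repeats, height w * φ w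
      = ∑ w, (if w ∈ N.repeats then height w else 0) * φ w := by
        simp only [ite_mul, zero_mul, Finset.sum_ite_mem, Finset.univ_inter]
    _ = _ := by
        simp only [N.indicator_repeats_height, add_mul, Finset.sum_add_distrib, hfst, hsnd, mul_add]

/-- The letters which may precede the pair `q` in a word whose normal form has exactly one repeated
letter. -/
def predecessors (q : X × X) : Finset X := {z | (z, q) ∈ N.repeats}

/-- The letters which may follow the pair `q` in a word whose normal form has exactly one repeated
letter. -/
def successors (q : X × X) : Finset X := {z | (q.1, q.2, z) ∈ N.repeats}

theorem mem_predecessors {q : X × X} {z : X} : z ∈ N.predecessors q ↔ (z, q) ∈ N.repeats := by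
  simp [predecessors]

theorem mem_successors {q : X × X} {z : X} :
    z ∈ N.successors q ↔ (q.1, q.2, z) ∈ N.repeats := by
  simp [successors]

theorem predecessors_map (q : X × X) : N.predecessors (r.map q) = N.predecessors q := by
  ext z
  simp only [mem_predecessors]
  exact N.right_mem_repeats (w := (z, q))

theorem successors_map (q : X × X) : N.successors (r.map q) = N.successors q := by
  ext z
  simp only [mem_successors]
  exact N.left_mem_repeats (w := (q.1, q.2, z))

theorem sum_card_predecessors (φ : X → ℤ) :
    ∑ q : X × X, descentSign q * φ q.2 * ((N.predecessors q).card - 2) = 0 := by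
  have hleft : ∑ w ∈ N.repeats, descentSign (w.1, w.2.1) * φ w.2.2 = 0 :=
    sum_eq_zero_of_involutive_neg r.left_involutive (fun _ => N.left_mem_repeats.2) fun w _ =>
      (congrArg (· * φ w.2.2) (r.descentSign_map (w.1, w.2.1))).trans (neg_mul _ _)
  have hright : ∑ w ∈ N.repeats, descentSign w.2 * φ w.2.2 =
      ∑ q : X × X, descentSign q * φ q.2 * (N.predecessors q).card := by
    simp only [predecessors, Finset.card_filter, Nat.cast_sum, Nat.cast_ite, Nat.cast_one,
      Nat.cast_zero, Finset.mul_sum, mul_ite, mul_one, mul_zero]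
    rw [← Fintype.sum_prod_type_right', Finset.sum_ite_mem, Finset.univ_inter]
  have hsum := N.sum_repeats_height_mul fun w => φ w.2.2
  simp only [height, add_mul, Finset.sum_add_distrib, hleft, hright, zero_add, mul_add] at hsum
  simp only [mul_sub, Finset.sum_sub_distrib, ← Finset.sum_mul, hsum]
  ring

theorem sum_card_successors (φ : X → ℤ) :
    ∑ q : X × X, descentSign q * φ q.1 * ((N.successors q).card - 2) = 0 := by
  have hright : ∑ w ∈ N.repeats, descentSign w.2 * φ w.1 = 0 :=
    sum_eq_zero_of_involutive_neg r.right_involutive (fun _ => N.right_mem_repeats.2) fun w _ =>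
      (congrArg (· * φ w.1) (r.descentSign_map w.2)).trans (neg_mul _ _)
  have hleft : ∑ w ∈ N.repeats, descentSign (w.1, w.2.1) * φ w.1 =
      ∑ q : X × X, descentSign q * φ q.1 * (N.successors q).card := by
    simp only [successors, Finset.card_filter, Nat.cast_sum, Nat.cast_ite, Nat.cast_one,
      Nat.cast_zero, Finset.mul_sum, mul_ite, mul_one, mul_zero]
    rw [← Fintype.sum_prod_type', Fintype.sum_equiv (Equiv.prodAssoc X X X) _
      fun w => if w ∈ N.repeats then descentSign (w.1, w.2.1) * φ w.1 else 0]
    · rw [Finset.sum_ite_mem, Finset.univ_inter]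
    · exact fun _ => rfl
  have hsum := N.sum_repeats_height_mul fun w => φ w.1
  simp only [height, add_mul, Finset.sum_add_distrib, hleft, hright, add_zero, mul_add] at hsum
  simp only [mul_sub, Finset.sum_sub_distrib, ← Finset.sum_mul, hsum]
  ring

theorem pair_subset_predecessors {q : X × X} (hq : q.2 < q.1) :
    {q.1, (r.map q).1} ⊆ N.predecessors q := by
  rw [Finset.insert_subset_iff, Finset.singleton_subset_iff]
  refine ⟨N.mem_predecessors.2 (N.mk_self_fst_mem_repeats hq.ne'), ?_⟩
  rw [← predecessors_map]
  exact N.mem_predecessors.2 (N.mk_self_fst_mem_repeats (r.map_fst_lt_snd hq).ne)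

theorem pair_subset_successors {q : X × X} (hq : q.2 < q.1) :
    {q.2, (r.map q).2} ⊆ N.successors q := by
  rw [Finset.insert_subset_iff, Finset.singleton_subset_iff]
  refine ⟨N.mem_successors.2 (N.mk_self_snd_mem_repeats hq.ne'), ?_⟩
  rw [← successors_map]
  exact N.mem_successors.2 (N.mk_self_snd_mem_repeats (r.map_fst_lt_snd hq).ne)

theorem two_le_card_predecessors {q : X × X} (hq : q.2 < q.1) :
    2 ≤ (N.predecessors q).card := by
  simpa only [Finset.card_pair (r.map_fst_lt hq).ne'] using
    Finset.card_le_card (N.pair_subset_predecessors hq)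

omit [Fintype X] in
theorem le_map_snd [Finite X] (N : r.NormalForm) {q : X × X} (hq : q.2 < q.1) :
    q.2 ≤ (r.map q).2 := by
  cases nonempty_fintype X
  by_contra! h
  have hmem : (q.1, q.2, q.2) ∈ N.repeats := N.mk_self_snd_mem_repeats hq.ne'
  exact N.not_lt_lt_of_mem_repeats (N.left_mem_repeats.2 hmem) ⟨r.map_fst_lt_snd hq, h⟩

theorem predecessors_eq {q : X × X} (hq : q.2 < q.1) (hne : (r.map q).2 ≠ q.2) :
    N.predecessors q = {q.1, (r.map q).1} := by
  obtain ⟨φ⟩ := nonempty_orderEmbedding_of_finite_infinite X ℤ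
  have hzero := r.sub_mul_eq_zero_of_sum_eq_zero (f := fun q => -φ q.2)
    (g := fun q => (N.predecessors q).card - 2)
    (by simpa using N.sum_card_predecessors φ)
    (fun q => by rw [N.predecessors_map])
    (fun q hq => mul_nonneg (by simpa using N.le_map_snd hq)
      (by simpa using N.two_le_card_predecessors hq)) hq
  have hcard : (N.predecessors q).card = 2 := by
    rcases mul_eq_zero.1 hzero with h | h
    · exact absurd (φ.injective (by omega)) hne
    · omega
  exact (Finset.eq_of_subset_of_card_le (N.pair_subset_predecessors hq)
    (by rw [hcard, Finset.card_pair (r.map_fst_lt hq).ne'])).symm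

omit [Fintype X] in
theorem injOn_map_snd [Finite X] (N : r.NormalForm) {v : X}
    (hv : ∀ y, v < y → v < (r.map (y, v)).2) :
    Set.InjOn (fun y => (r.map (y, v)).2) (Set.Ioi v) := by
  cases nonempty_fintype X
  -- The predecessors of the pair `(b, v)` with `b = (r (y, v)).2` determine `(r (y, v)).1`.
  have hfst : ∀ y, v < y → (r.map (y, v)).1 = (r.map ((r.map (y, v)).2, v)).1 := by
    intro y hy
    have hb := hv y hy
    have hmem : (r.map (y, v)).1 ∈ N.predecessors ((r.map (y, v)).2, v) :=
      N.mem_predecessors.2 (N.left_mem_repeats.2 (N.mk_self_snd_mem_repeats (q := (y, v)) hy.ne'))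
    rw [N.predecessors_eq hb (hv _ hb).ne', Finset.mem_insert, Finset.mem_singleton] at hmem
    exact hmem.resolve_left (r.map_fst_lt_snd (q := (y, v)) hy).ne
  intro y₁ h₁ y₂ h₂ (h : (r.map (y₁, v)).2 = (r.map (y₂, v)).2)
  have hmap : r.map (y₁, v) = r.map (y₂, v) := Prod.ext (by rw [hfst _ h₁, hfst _ h₂, h]) h
  exact congrArg Prod.fst (r.map_injective hmap)

omit [Fintype X] in
theorem exists_map_snd_eq [Finite X] (N : r.NormalForm) {v z : X}
    (hv : ∀ y, v < y → v < (r.map (y, v)).2) (hz : v < z) : ∃ c < z, (r.map (c, z)).2 = v := by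
  obtain ⟨y, hy, rfl⟩ := ((Set.toFinite _).injOn_iff_bijOn_of_mapsTo hv).1 (N.injOn_map_snd hv)
    |>.surjOn hz
  exact ⟨(r.map (y, v)).1, r.map_fst_lt_snd (q := (y, v)) hy, by
    simp only [Prod.mk.eta, r.map_map]⟩

omit [Fintype X] in
theorem lt_map_snd [Finite X] (N : r.NormalForm) {y z : X} (hzy : z < y) :
    z < (r.map (y, z)).2 := by
  induction z using WellFoundedLT.induction generalizing y with
  | ind z ih =>
    refine (N.le_map_snd (q := (y, z)) hzy).lt_of_ne fun (hz : z = (r.map (y, z)).2) => ?_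
    have hex : ∀ v : Set.Iio z, ∃ c : Set.Iio z, (r.map (c, z)).2 = v := fun v => by
      obtain ⟨c, hc, h⟩ := N.exists_map_snd_eq (fun y => ih v v.2) v.2
      exact ⟨⟨c, hc⟩, h⟩
    choose c hc using hex
    have hinj : Function.Injective c := fun v₁ v₂ h => Subtype.ext (by rw [← hc v₁, ← hc v₂, h])
    have ha : (r.map (y, z)).1 < z := (r.map_fst_lt_snd hzy).trans_eq hz.symm
    obtain ⟨v, hv⟩ := Finite.injective_iff_surjective.1 hinj ⟨_, ha⟩
    have hmap : r.map ((r.map (y, z)).1, z) = (y, z) := by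
      rw [show ((r.map (y, z)).1, z) = r.map (y, z) from Prod.ext rfl hz, r.map_map]
    have hvz := hc v
    rw [hv, hmap] at hvz
    exact v.2.ne hvz.symm

theorem two_le_card_successors {q : X × X} (hq : q.2 < q.1) : 2 ≤ (N.successors q).card := by
  simpa only [Finset.card_pair (N.lt_map_snd hq).ne] using
    Finset.card_le_card (N.pair_subset_successors hq)

theorem successors_eq {q : X × X} (hq : q.2 < q.1) : N.successors q = {q.2, (r.map q).2} := by
  obtain ⟨φ⟩ := nonempty_orderEmbedding_of_finite_infinite X ℤ
  have hzero := r.sub_mul_eq_zero_of_sum_eq_zero (f := fun q => φ q.1)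
    (g := fun q => (N.successors q).card - 2) (N.sum_card_successors φ)
    (fun q => by rw [N.successors_map])
    (fun q hq => mul_nonneg (by simpa using (r.map_fst_lt hq).le)
      (by simpa using N.two_le_card_successors hq)) hq
  have hcard : (N.successors q).card = 2 := by
    rcases mul_eq_zero.1 hzero with h | h
    · exact absurd (φ.injective (by omega)) (r.map_fst_lt hq).ne
    · omega
  exact (Finset.eq_of_subset_of_card_le (N.pair_subset_successors hq)
    (by rw [hcard, Finset.card_pair (N.lt_map_snd hq).ne])).symm

omit [Fintype X] in
theorem map_snd_eq_of_ne [Finite X] (N : r.NormalForm) {x y : X} (hxy : x ≠ y) :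
    (r.map (x, y)).2 = (r.map (x, (r.map (x, y)).1)).2 := by
  cases nonempty_fintype X
  have hmem : (x, r.map (x, y)) ∈ N.repeats :=
    N.right_mem_repeats.2 (N.mk_self_fst_mem_repeats (q := (x, y)) hxy)
  have hsucc : (r.map (x, y)).2 ∈ N.successors (x, (r.map (x, y)).1) := N.mem_successors.2 hmem
  rcases hxy.lt_or_gt with h | h
  · rw [← N.successors_map, N.successors_eq (r.map_snd_lt_fst (r.lt_map_fst (q := (x, y)) h)),
      r.map_map, Finset.mem_insert, Finset.mem_singleton] at hsucc
    exact hsucc.resolve_right (r.map_snd_lt_fst (q := (x, y)) h).ne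
  · rw [N.successors_eq (r.map_fst_lt (q := (x, y)) h), Finset.mem_insert,
      Finset.mem_singleton] at hsucc
    exact hsucc.resolve_left (r.map_fst_lt_snd (q := (x, y)) h).ne'

omit [Fintype X] in
theorem map_fst_injective [Finite X] (N : r.NormalForm) (x : X) :
    Function.Injective fun y => (r.map (x, y)).1 := by
  intro y₁ y₂ (h : (r.map (x, y₁)).1 = (r.map (x, y₂)).1)
  rcases eq_or_ne x y₁ with rfl | h₁
  · rwa [r.map_diag, eq_comm, r.map_fst_eq_iff] at h
  · have h₂ : x ≠ y₂ := by rwa [Ne, ← r.map_fst_eq_iff, ← h, r.map_fst_eq_iff]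
    have hsnd : (r.map (x, y₁)).2 = (r.map (x, y₂)).2 := by
      rw [N.map_snd_eq_of_ne h₁, N.map_snd_eq_of_ne h₂, h]
    exact congrArg Prod.snd (r.map_injective (Prod.ext h hsnd))

end Orbit

end SkewInvolution.NormalForm

/-! ### Counting orbits -/

namespace Triple

variable {X : Type*} [LinearOrder X]

/-- The number of distinct rearrangements of a normal word, which will turn out to be the size of
its orbit. -/
def orbitSize (u : Triple X) : ℕ :=
  if u.1 = u.2.1 then if u.2.1 = u.2.2 then 1 else 3 else if u.2.1 = u.2.2 then 3 else 6

theorem card_hexagon_le_orbitSize {α : Type*} [DecidableEq α] {s t : α → α} {a : α} {u : Triple X}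
    (hs : u.1 = u.2.1 → s a = a) (ht : u.2.1 = u.2.2 → t a = a)
    (braid : s (t (s a)) = t (s (t a))) : (hexagon s t a).card ≤ orbitSize u := by
  unfold orbitSize
  split_ifs with h1 h2 h2
  · exact card_hexagon_le_one (hs h1) (ht h2)
  · exact card_hexagon_le_three_of_left_fixed (hs h1)
  · exact card_hexagon_le_three_of_right_fixed (ht h2) braid
  · exact card_hexagon_le_six

/-- The weakly increasing rearrangement of a word. -/
def sort (w : Triple X) : Triple X :=
  (min w.1 (min w.2.1 w.2.2), max (min w.1 w.2.1) (min (max w.1 w.2.1) w.2.2),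
    max w.1 (max w.2.1 w.2.2))

theorem isNormal_sort (w : Triple X) : IsNormal (sort w) := by
  obtain ⟨x, y, z⟩ := w
  simp only [IsNormal, sort]
  grind

end Triple

namespace SkewInvolution

open Triple

variable {X : Type*} [LinearOrder X]

theorem exists_mem_hexagon [WellFoundedLT X] (r : SkewInvolution X)
    (braid : ∀ w, r.left (r.right (r.left w)) = r.right (r.left (r.right w))) (w : Triple X) :
    ∃ u, IsNormal u ∧ w ∈ hexagon r.left r.right u := by
  induction w using r.triple_induction with
  | normal w hw => exact ⟨w, hw, self_mem_hexagon⟩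
  | left w _ ih =>
    obtain ⟨u, hu, hmem⟩ := ih
    refine ⟨u, hu, ?_⟩
    simpa only [r.left_involutive w] using
      left_mem_hexagon r.left_involutive r.right_involutive braid hmem
  | right w _ ih =>
    obtain ⟨u, hu, hmem⟩ := ih
    refine ⟨u, hu, ?_⟩
    simpa only [r.right_involutive w] using
      right_mem_hexagon r.left_involutive r.right_involutive braid hmem

variable (X) in
/-- The flip `xy ↦ yx`, which belongs to the commutative polynomial algebra. Its orbits are the sets
of rearrangements of a word. -/
def flip : SkewInvolution X where
  map := Prod.swap
  map_map := Prod.swap_swap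
  map_diag _ := rfl
  map_fst_lt_snd := id
  map_snd_lt_fst := id
  map_fst_lt := id

/-- Sorting, as a normal form for the flip. -/
def flipNormalForm : (flip X).NormalForm where
  nf := sort
  nf_left w := by
    simp only [sort, left, flip, Prod.swap]
    rw [min_left_comm, min_comm w.1 w.2.1, max_comm w.1 w.2.1, max_left_comm]
  nf_right w := by
    obtain ⟨x, y, z⟩ := w
    simp only [sort, right, flip, Prod.swap, Prod.mk.injEq]
    grind
  isNormal_nf := isNormal_sort
  nf_eq_self h := by
    simp only [sort]
    grind [IsNormal]

namespace NormalForm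

variable [Fintype X] {r : SkewInvolution X} (N : r.NormalForm)

theorem sum_card_orbit :
    ∑ u : Triple X with IsNormal u, (N.orbit u).card = Fintype.card (Triple X) :=
  (Finset.card_eq_sum_card_fiberwise fun w _ => by simpa using N.isNormal_nf w).symm

theorem ne_of_mem_orbit_of_strict {u w : Triple X} (hu : u.1 < u.2.1 ∧ u.2.1 < u.2.2)
    (hw : w ∈ N.orbit u) : w.1 ≠ w.2.1 ∧ w.2.1 ≠ w.2.2 := by
  have hheight : height (N.nf w) = -2 := by
    rwa [N.mem_orbit.1 hw, height_eq_neg_two_iff]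
  have hrep : w ∉ N.repeats := fun h => by
    rw [mem_repeats, hheight] at h
    omega
  obtain ⟨x, y, z⟩ := w
  have hconst : x = y → y ≠ z := by
    rintro rfl rfl
    rw [N.nf_eq_self ⟨le_rfl, le_rfl⟩] at hheight
    simp [height] at hheight
  constructor
  · rintro (rfl : x = y)
    exact hrep (N.mk_self_fst_mem_repeats (q := (x, z)) (hconst rfl))
  · rintro (rfl : y = z)
    exact hrep (N.mk_self_snd_mem_repeats (q := (x, y)) fun h => hconst h rfl)

theorem six_le_card_orbit {u : Triple X} (hu : u.1 < u.2.1 ∧ u.2.1 < u.2.2) :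
    6 ≤ (N.orbit u).card ∧ ((N.orbit u).card = 6 → ∀ w ∈ N.orbit u,
      r.left (r.right (r.left w)) = r.right (r.left (r.right w))) := by
  have hne := fun w => N.ne_of_mem_orbit_of_strict (w := w) hu
  refine six_le_card_of_involutive r.left_involutive r.right_involutive
    (fun _ => N.left_mem_orbit) (fun _ => N.right_mem_orbit)
    (fun w hw h => (hne w hw).1 (r.left_eq_self_iff.1 h))
    (fun w hw h => (hne w hw).2 (r.right_eq_self_iff.1 h))
    (fun w hw h => (hne w hw).1 (r.map_fst_eq_iff.1 (congrArg Prod.fst h))) (fun w hw h => ?_)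
    (N.self_mem_orbit ⟨hu.1.le, hu.2.le⟩)
  -- The first letters of the two words are those of `r (x, a)` and `r (x, y)`, `a = (r (y, z)).1`.
  have hfst : (r.map (w.1, (r.map w.2).1)).1 = (r.map (w.1, w.2.1)).1 :=
    congrArg (fun v : Triple X => v.1) h
  exact (hne w hw).2 (r.map_fst_eq_iff.1 (N.map_fst_injective w.1 hfst))

theorem three_le_card_orbit_of_fst_eq {u : Triple X} (hu : u.1 = u.2.1 ∧ u.2.1 < u.2.2) :
    3 ≤ (N.orbit u).card ∧ ((N.orbit u).card = 3 → ∀ w ∈ N.orbit u,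
      r.left (r.right (r.left w)) = r.right (r.left (r.right w))) := by
  refine three_le_card_of_involutive r.left_involutive r.right_involutive
    (fun _ => N.left_mem_orbit) (fun _ => N.right_mem_orbit)
    (N.self_mem_orbit ⟨hu.1.le, hu.2.le⟩) (r.left_eq_self_iff.2 hu.1)
    (fun h => hu.2.ne (r.right_eq_self_iff.1 h)) fun h => hu.2.ne ?_
  have hfst : u.1 = (r.map u.2).1 := r.left_eq_self_iff.1 h
  exact r.map_fst_eq_iff.1 (hfst.symm.trans hu.1)

theorem three_le_card_orbit_of_snd_eq {u : Triple X} (hu : u.1 < u.2.1 ∧ u.2.1 = u.2.2) :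
    3 ≤ (N.orbit u).card ∧ ((N.orbit u).card = 3 → ∀ w ∈ N.orbit u,
      r.right (r.left (r.right w)) = r.left (r.right (r.left w))) := by
  refine three_le_card_of_involutive r.right_involutive r.left_involutive
    (fun _ => N.right_mem_orbit) (fun _ => N.left_mem_orbit)
    (N.self_mem_orbit ⟨hu.1.le, hu.2.le⟩) (r.right_eq_self_iff.2 hu.2)
    (fun h => hu.1.ne (r.left_eq_self_iff.1 h)) fun h => ?_
  have hsnd : (r.map (u.1, u.2.1)).2 = u.2.1 := (r.right_eq_self_iff.1 h).trans hu.2.symm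
  have hlt := N.lt_map_snd (r.map_snd_lt_fst (q := (u.1, u.2.1)) hu.1)
  rw [Prod.mk.eta, r.map_map, hsnd] at hlt
  exact lt_irrefl _ hlt

theorem orbitSize_le_card_orbit {u : Triple X} (hu : IsNormal u) :
    orbitSize u ≤ (N.orbit u).card ∧ ((N.orbit u).card = orbitSize u → ∀ w ∈ N.orbit u,
      r.left (r.right (r.left w)) = r.right (r.left (r.right w))) := by
  unfold orbitSize
  split_ifs with h1 h2 h2
  · refine ⟨Finset.card_pos.2 ⟨u, N.self_mem_orbit hu⟩, fun h w hw => ?_⟩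
    refine Finset.card_le_one.1 h.le _ ?_ _ ?_
    · exact N.left_mem_orbit (N.right_mem_orbit (N.left_mem_orbit hw))
    · exact N.right_mem_orbit (N.left_mem_orbit (N.right_mem_orbit hw))
  · exact N.three_le_card_orbit_of_fst_eq ⟨h1, hu.2.lt_of_ne h2⟩
  · have h := N.three_le_card_orbit_of_snd_eq ⟨hu.1.lt_of_ne h1, h2⟩
    exact ⟨h.1, fun hcard w hw => (h.2 hcard w hw).symm⟩
  · exact N.six_le_card_orbit ⟨hu.1.lt_of_ne h1, hu.2.lt_of_ne h2⟩

end NormalForm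

theorem sum_orbitSize [Fintype X] :
    ∑ u : Triple X with IsNormal u, orbitSize u = Fintype.card (Triple X) := by
  refine le_antisymm ?_ ?_
  · rw [← (flipNormalForm (X := X)).sum_card_orbit]
    exact Finset.sum_le_sum fun u hu =>
      (flipNormalForm.orbitSize_le_card_orbit (Finset.mem_filter.1 hu).2).1
  · have hcover : (Finset.univ : Finset (Triple X)) ⊆
        ({u : Triple X | IsNormal u} : Finset _).biUnion
          (hexagon (flip X).left (flip X).right) := by
      intro w _
      obtain ⟨u, hu, hw⟩ := (flip X).exists_mem_hexagon (fun _ => rfl) w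
      exact Finset.mem_biUnion.2 ⟨u, by simpa using hu, hw⟩
    refine (Finset.card_le_card hcover).trans (Finset.card_biUnion_le.trans ?_)
    exact Finset.sum_le_sum fun u _ => card_hexagon_le_orbitSize
      (flip X).left_eq_self_iff.2 (flip X).right_eq_self_iff.2 rfl

namespace NormalForm

variable {r : SkewInvolution X}

theorem card_orbit [Fintype X] (N : r.NormalForm) {u : Triple X} (hu : IsNormal u) :
    (N.orbit u).card = orbitSize u := by
  have hsum := sum_orbitSize.trans N.sum_card_orbit.symm
  exact ((Finset.sum_eq_sum_iff_of_le fun u hu =>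
    (N.orbitSize_le_card_orbit (Finset.mem_filter.1 hu).2).1).1 hsum u (by simpa using hu)).symm

theorem braid [Finite X] (N : r.NormalForm) (w : Triple X) :
    r.left (r.right (r.left w)) = r.right (r.left (r.right w)) := by
  cases nonempty_fintype X
  exact (N.orbitSize_le_card_orbit (N.isNormal_nf w)).2 (N.card_orbit (N.isNormal_nf w)) w
    (N.mem_orbit.2 rfl)

end NormalForm

end SkewInvolution

/-! ### Scalar multiples of words of length three -/

/-- The data of `R(ℜ₀)`: a skew involution `r` together with scalars, standing for the monomial map
`x ⊗ y ↦ coeff (x, y) • r (x, y)`. The scalars live in an arbitrary commutative group, which will be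
the group of units of the ground field. -/
structure MonomialInvolution (G X : Type*) [CommGroup G] [LinearOrder X] extends
    SkewInvolution X where
  /-- the scalar produced by a word of length two -/
  coeff : X × X → G
  coeff_map : ∀ q, coeff (map q) = (coeff q)⁻¹
  coeff_diag : ∀ x, coeff (x, x) = 1

namespace MonomialInvolution

open Triple

variable {G X : Type*} [CommGroup G] [LinearOrder X] (R : MonomialInvolution G X)

/-- `R ⊗ id` on scalar multiples of words of length three. -/
def termLeft (p : G × Triple X) : G × Triple X :=
  (p.1 * R.coeff (p.2.1, p.2.2.1), R.left p.2)

/-- `id ⊗ R` on scalar multiples of words of length three. -/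
def termRight (p : G × Triple X) : G × Triple X := (p.1 * R.coeff p.2.2, R.right p.2)

/-- The braid relation for the two actions of `R` on scalar multiples of words of length three. -/
def IsBraided : Prop :=
  ∀ p, R.termLeft (R.termRight (R.termLeft p)) = R.termRight (R.termLeft (R.termRight p))

/-- Normal forms of words of length three with scalars: `w` reduces to `scalar w • nf w`. -/
structure TermNormalForm extends R.toSkewInvolution.NormalForm where
  /-- the scalar in front of the normal form of a word -/
  scalar : Triple X → G
  scalar_eq_one : ∀ {w : Triple X}, w.IsNormal → scalar w = 1
  scalar_left : ∀ w : Triple X, scalar w = R.coeff (w.1, w.2.1) * scalar (R.left w)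
  scalar_right : ∀ w : Triple X, scalar w = R.coeff w.2 * scalar (R.right w)

theorem termLeft_involutive : Function.Involutive R.termLeft := fun p => by
  refine Prod.ext ?_ (R.left_involutive _)
  change p.1 * R.coeff (p.2.1, p.2.2.1) * R.coeff (R.map (p.2.1, p.2.2.1)) = p.1
  rw [R.coeff_map, mul_inv_cancel_right]

theorem termRight_involutive : Function.Involutive R.termRight := fun p => by
  refine Prod.ext ?_ (R.right_involutive _)
  change p.1 * R.coeff p.2.2 * R.coeff (R.map p.2.2) = p.1
  rw [R.coeff_map, mul_inv_cancel_right]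

theorem termLeft_eq_self {p : G × Triple X} (h : p.2.1 = p.2.2.1) : R.termLeft p = p := by
  refine Prod.ext ?_ (R.left_eq_self_iff.2 h)
  simp only [termLeft, h, R.coeff_diag, mul_one]

theorem termRight_eq_self {p : G × Triple X} (h : p.2.2.1 = p.2.2.2) : R.termRight p = p := by
  refine Prod.ext ?_ (R.right_eq_self_iff.2 h)
  change p.1 * R.coeff (p.2.2.1, p.2.2.2) = p.1
  rw [h, R.coeff_diag, mul_one]

theorem TermNormalForm.isBraided [Finite X] {R : MonomialInvolution G X} (N : R.TermNormalForm) :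
    R.IsBraided := by
  have value_left : ∀ p, (R.termLeft p).1 * N.scalar (R.termLeft p).2 = p.1 * N.scalar p.2 :=
    fun p => by
      rw [N.scalar_left p.2, ← mul_assoc]
      rfl
  have value_right : ∀ p, (R.termRight p).1 * N.scalar (R.termRight p).2 = p.1 * N.scalar p.2 :=
    fun p => by
      rw [N.scalar_right p.2, ← mul_assoc]
      rfl
  intro p
  have hword : (R.termLeft (R.termRight (R.termLeft p))).2
      = (R.termRight (R.termLeft (R.termRight p))).2 := N.braid p.2
  refine Prod.ext (mul_right_cancel (b := N.scalar (R.termLeft (R.termRight (R.termLeft p))).2) ?_)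
    hword
  conv_rhs => rw [hword]
  rw [value_left, value_right, value_left, value_right, value_left, value_right]

variable {R}

theorem IsBraided.braid (hR : R.IsBraided) (w : Triple X) :
    R.left (R.right (R.left w)) = R.right (R.left (R.right w)) :=
  congrArg Prod.snd (hR (1, w))

section TermOrbit

variable [DecidableEq G]

variable (R) in
/-- The orbit of the term `1 • u` under the two actions of a braided `R`. -/
def termOrbit (u : Triple X) : Finset (G × Triple X) :=
  hexagon R.termLeft R.termRight (1, u)

theorem self_mem_termOrbit (u : Triple X) : (1, u) ∈ R.termOrbit u := self_mem_hexagon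

variable {u : Triple X} {p : G × Triple X}

theorem IsBraided.termLeft_mem (hR : R.IsBraided) (hp : p ∈ R.termOrbit u) :
    R.termLeft p ∈ R.termOrbit u :=
  left_mem_hexagon R.termLeft_involutive R.termRight_involutive hR hp

theorem IsBraided.termRight_mem (hR : R.IsBraided) (hp : p ∈ R.termOrbit u) :
    R.termRight p ∈ R.termOrbit u :=
  right_mem_hexagon R.termLeft_involutive R.termRight_involutive hR hp

theorem IsBraided.card_termOrbit_le (hR : R.IsBraided) (u : Triple X) :
    (R.termOrbit u).card ≤ orbitSize u :=
  card_hexagon_le_orbitSize (fun h => R.termLeft_eq_self h) (fun h => R.termRight_eq_self h)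
    (hR (1, u))

theorem IsBraided.exists_mem_termOrbit [WellFoundedLT X] (hR : R.IsBraided) (w : Triple X) :
    ∃ u, IsNormal u ∧ ∃ c, (c, w) ∈ R.termOrbit u := by
  obtain ⟨u, hu, hw⟩ := R.exists_mem_hexagon hR.braid w
  have himage : (R.termOrbit u).image Prod.snd = hexagon R.left R.right u :=
    image_hexagon (f := Prod.snd) (s := R.termLeft) (t := R.termRight) (fun _ => rfl)
      (fun _ => rfl) (1, u)
  rw [← himage] at hw
  obtain ⟨p, hmem, rfl⟩ := Finset.mem_image.1 hw
  exact ⟨u, hu, p.1, hmem⟩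

/-- The orbits of the normal words cover all words, but have altogether no more elements than there
are words. Hence no word occurs twice in them. -/
theorem IsBraided.termOrbit_unique [Finite X] (hR : R.IsBraided) {w u u' : Triple X} {c c' : G}
    (hu : IsNormal u) (hu' : IsNormal u') (h : (c, w) ∈ R.termOrbit u)
    (h' : (c', w) ∈ R.termOrbit u') : u = u' ∧ c = c' := by
  cases nonempty_fintype X
  let total : Finset (Σ _ : Triple X, G × Triple X) :=
    ({u : Triple X | IsNormal u} : Finset _).sigma R.termOrbit
  have hmem : ∀ {u c w}, IsNormal u → (c, w) ∈ R.termOrbit u →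
      (⟨u, c, w⟩ : Σ _ : Triple X, G × Triple X) ∈ total := fun hu h =>
    Finset.mem_sigma.2 ⟨by simpa using hu, h⟩
  have himage : total.image (fun a => a.2.2) = Finset.univ := by
    refine Finset.eq_univ_of_forall fun w => ?_
    obtain ⟨u, hu, c, hc⟩ := hR.exists_mem_termOrbit w
    exact Finset.mem_image.2 ⟨_, hmem hu hc, rfl⟩
  have hcard : total.card ≤ (total.image fun a => a.2.2).card := by
    rw [himage, Finset.card_univ, ← SkewInvolution.sum_orbitSize, Finset.card_sigma]
    exact Finset.sum_le_sum fun u _ => hR.card_termOrbit_le u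
  have hinj := Finset.card_image_iff.1 (le_antisymm Finset.card_image_le hcard)
  simpa using hinj (hmem hu h) (hmem hu' h') rfl

end TermOrbit

theorem IsBraided.nonempty_termNormalForm [Finite X] (hR : R.IsBraided) :
    Nonempty R.TermNormalForm := by
  classical
  choose nf hnf c hc using hR.exists_mem_termOrbit
  have left : ∀ w, nf w = nf (R.left w) ∧ c w * R.coeff (w.1, w.2.1) = c (R.left w) := fun w =>
    hR.termOrbit_unique (hnf _) (hnf _) (hR.termLeft_mem (hc w)) (hc _)
  have right : ∀ w, nf w = nf (R.right w) ∧ c w * R.coeff w.2 = c (R.right w) := fun w =>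
    hR.termOrbit_unique (hnf _) (hnf _) (hR.termRight_mem (hc w)) (hc _)
  have normal : ∀ {w : Triple X}, w.IsNormal → nf w = w ∧ c w = 1 := fun {w} hw =>
    hR.termOrbit_unique (hnf _) hw (hc w) (self_mem_termOrbit w)
  exact ⟨{
    nf := nf
    nf_left := fun w => (left w).1.symm
    nf_right := fun w => (right w).1.symm
    isNormal_nf := hnf
    nf_eq_self := fun hw => (normal hw).1
    scalar := fun w => (c w)⁻¹
    scalar_eq_one := fun hw => inv_eq_one.2 (normal hw).2
    scalar_left := fun w => by
      rw [← (left w).2, mul_inv_rev, mul_inv_cancel_left]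
    scalar_right := fun w => by
      rw [← (right w).2, mul_inv_rev, mul_inv_cancel_left] }⟩

theorem isBraided_iff_nonempty_termNormalForm [Finite X] (R : MonomialInvolution G X) :
    R.IsBraided ↔ Nonempty R.TermNormalForm :=
  ⟨IsBraided.nonempty_termNormalForm, fun ⟨N⟩ => N.isBraided⟩

end MonomialInvolution

/-! ### Rewriting of words -/

/-- The diamond lemma for rewriting systems whose rules replace an object by a multiple of a smaller
one: `F` is built by well-founded recursion, and local confluence makes it independent of the choice
of a rule. -/
theorem exists_normalForm_of_locally_confluent {G α M : Type*} [SMul G M] {lt : α → α → Prop}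
    (wf : WellFounded lt) {step : α → G → α → Prop} (hlt : ∀ {a c b}, step a c b → lt b a)
    (base : α → M)
    (confluent : ∀ (a : α) (F : α → M),
      (∀ a' c b, lt a' a → step a' c b → F a' = c • F b) →
      ∀ c b c' b', step a c b → step a c' b' → c • F b = c' • F b') :
    ∃ F : α → M, (∀ a c b, step a c b → F a = c • F b) ∧
      ∀ a, (∀ c b, ¬ step a c b) → F a = base a := by
  classical
  let recStep : (a : α) → ((b : α) → lt b a → M) → M := fun a ih =>
    if h : ∃ d : G × α, step a d.1 d.2 then h.choose.1 • ih h.choose.2 (hlt h.choose_spec)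
    else base a
  let F : α → M := wf.fix recStep
  have hF : ∀ a, F a = recStep a fun b _ => F b := wf.fix_eq recStep
  refine ⟨F, fun a => ?_, fun a ha => ?_⟩
  · induction a using wf.induction with
    | _ a ih =>
      intro c b hs
      have h : ∃ d : G × α, step a d.1 d.2 := ⟨(c, b), hs⟩
      have hchoose : F a = h.choose.1 • F h.choose.2 := (hF a).trans (dif_pos h)
      rw [hchoose]
      exact confluent a F (fun a' c b hl hs => ih a' hl c b hs) _ _ _ _ h.choose_spec hs
  · exact (hF a).trans (dif_neg fun ⟨d, hd⟩ => ha _ _ hd)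

section Shortlex

variable {X : Type*} [LinearOrder X]

instance isTrans_shortlex : IsTrans (List X) (List.Shortlex (· < ·)) where
  trans s t u hst htu := by
    rw [List.shortlex_def] at *
    rcases hst with h | ⟨h, hlex⟩ <;> rcases htu with h' | ⟨h', hlex'⟩
    · exact .inl (h.trans h')
    · exact .inl (h.trans_eq h')
    · exact .inl (h.trans_lt h')
    · exact .inr ⟨h.trans h', List.lt_trans (α := X) hlex hlex'⟩

theorem shortlex_append_cons_cons (p q : List X) {a x : X} (h : a < x) (b y : X) :
    List.Shortlex (· < ·) (p ++ a :: b :: q) (p ++ x :: y :: q) :=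
  .append_left (.of_lex (by simp) (.rel h)) p

end Shortlex

/-- The letters of a word of length three. -/
def Triple.toList {X : Type*} (w : Triple X) : List X := [w.1, w.2.1, w.2.2]

theorem Triple.toList_injective {X : Type*} : Function.Injective (toList (X := X)) := by
  rintro ⟨x, y, z⟩ ⟨x', y', z'⟩ h
  simpa [toList] using h

theorem Triple.IsNormal.pairwise_toList {X : Type*} [LinearOrder X] {w : Triple X}
    (hw : w.IsNormal) : w.toList.Pairwise (· ≤ ·) := by
  simp [toList, hw.1, hw.2, hw.1.trans hw.2]

namespace MonomialInvolution

section Step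

variable {G X : Type*} [CommGroup G] [LinearOrder X] (R : MonomialInvolution G X)

/-- `R.Step l c l'` says that `l` is rewritten to `c • l'` by applying `R` to a descent in `l`. -/
def Step (l : List X) (c : G) (l' : List X) : Prop :=
  ∃ p q x y, y < x ∧ l = p ++ x :: y :: q ∧ c = R.coeff (x, y) ∧
    l' = p ++ (R.map (x, y)).1 :: (R.map (x, y)).2 :: q

variable {R} {l l' : List X} {c : G}

theorem Step.shortlex (h : R.Step l c l') : List.Shortlex (· < ·) l' l := by
  obtain ⟨p, q, x, y, hxy, rfl, -, rfl⟩ := h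
  exact shortlex_append_cons_cons p q (R.map_fst_lt (q := (x, y)) hxy) _ _

theorem Step.append (h : R.Step l c l') (p q : List X) :
    R.Step (p ++ l ++ q) c (p ++ l' ++ q) := by
  obtain ⟨p', q', x, y, hxy, rfl, rfl, rfl⟩ := h
  exact ⟨p ++ p', q' ++ q, x, y, hxy, by simp, rfl, by simp⟩

theorem step_pair {x y : X} (h : y < x) :
    R.Step [x, y] (R.coeff (x, y)) [(R.map (x, y)).1, (R.map (x, y)).2] :=
  ⟨[], [], x, y, h, rfl, rfl, rfl⟩

theorem step_left {v : Triple X} (h : v.2.1 < v.1) :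
    R.Step v.toList (R.coeff (v.1, v.2.1)) (R.left v).toList :=
  (step_pair h).append [] [v.2.2]

theorem step_right {v : Triple X} (h : v.2.2 < v.2.1) :
    R.Step v.toList (R.coeff v.2) (R.right v).toList :=
  (step_pair h).append [v.1] []

end Step

section Confluence

variable {G X M : Type*} [CommGroup G] [LinearOrder X] [MulAction G M]
  (R : MonomialInvolution G X)

/-- `F` respects all rewriting steps that start below `w`. -/
def RespectsStepsBelow (F : List X → M) (w : List X) : Prop :=
  ∀ a c b, List.Shortlex (· < ·) a w → R.Step a c b → F a = c • F b

variable {R} {F : List X → M} {w : List X}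

theorem RespectsStepsBelow.eq_scalar_smul [WellFoundedLT X] (hF : R.RespectsStepsBelow F w)
    (N : R.TermNormalForm) (p q : List X) (v : Triple X)
    (hv : List.Shortlex (· < ·) (p ++ v.toList ++ q) w) :
    F (p ++ v.toList ++ q) = N.scalar v • F (p ++ (N.nf v).toList ++ q) := by
  induction v using R.triple_induction with
  | normal v h => rw [N.nf_eq_self h, N.scalar_eq_one h, one_smul]
  | left v h ih =>
    have hs := (step_left (R := R) h).append p q
    rw [hF _ _ _ hv hs, ih (trans_of _ hs.shortlex hv), N.nf_left, N.scalar_left v, mul_smul]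
  | right v h ih =>
    have hs := (step_right (R := R) h).append p q
    rw [hF _ _ _ hv hs, ih (trans_of _ hs.shortlex hv), N.nf_right, N.scalar_right v, mul_smul]

/-- Overlapping descents: both results reduce to the normal form of the word of length three. -/
theorem RespectsStepsBelow.confluent_overlap [WellFoundedLT X] {p q : List X} {v : Triple X}
    (hF : R.RespectsStepsBelow F (p ++ v.toList ++ q)) (N : R.TermNormalForm)
    (hleft : v.2.1 < v.1) (hright : v.2.2 < v.2.1) :
    R.coeff (v.1, v.2.1) • F (p ++ (R.left v).toList ++ q)
      = R.coeff v.2 • F (p ++ (R.right v).toList ++ q) := by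
  rw [hF.eq_scalar_smul N p q _ ((step_left hleft).append p q).shortlex,
    hF.eq_scalar_smul N p q _ ((step_right hright).append p q).shortlex, N.nf_left, N.nf_right,
    smul_smul, smul_smul, ← N.scalar_left, ← N.scalar_right]

theorem RespectsStepsBelow.confluent_disjoint {l₁ l₂ l₁' l₂' t p q : List X} {c₁ c₂ : G}
    (hF : R.RespectsStepsBelow F (p ++ l₁ ++ (t ++ l₂ ++ q)))
    (h₁ : R.Step l₁ c₁ l₁') (h₂ : R.Step l₂ c₂ l₂') :
    c₁ • F (p ++ l₁' ++ (t ++ l₂ ++ q)) = c₂ • F (p ++ l₁ ++ (t ++ l₂' ++ q)) := by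
  have step₁ : ∀ l, R.Step (p ++ l₁ ++ (t ++ l ++ q)) c₁ (p ++ l₁' ++ (t ++ l ++ q)) :=
    fun l => h₁.append p (t ++ l ++ q)
  have step₂ : ∀ l, R.Step (p ++ l ++ (t ++ l₂ ++ q)) c₂ (p ++ l ++ (t ++ l₂' ++ q)) := fun l => by
    simpa only [List.append_assoc] using h₂.append (p ++ l ++ t) q
  rw [hF _ _ _ (step₁ l₂).shortlex (step₂ l₁'), hF _ _ _ (step₂ l₁).shortlex (step₁ l₂'), smul_comm]

theorem RespectsStepsBelow.confluent_append [WellFoundedLT X] {p q t q' : List X} {x y x' y' : X}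
    (hF : R.RespectsStepsBelow F (p ++ x :: y :: q)) (N : R.TermNormalForm) (hxy : y < x)
    (hxy' : y' < x') (h : x :: y :: q = t ++ x' :: y' :: q') :
    R.coeff (x, y) • F (p ++ (R.map (x, y)).1 :: (R.map (x, y)).2 :: q)
      = R.coeff (x', y') • F (p ++ (t ++ (R.map (x', y')).1 :: (R.map (x', y')).2 :: q')) := by
  match t, h with
  | [], h =>
    simp only [List.nil_append, List.cons.injEq] at h
    obtain ⟨rfl, rfl, rfl⟩ := h
    rfl
  | [_], h =>
    simp only [List.cons_append, List.nil_append, List.cons.injEq] at h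
    obtain ⟨rfl, rfl, rfl⟩ := h
    have hF' : R.RespectsStepsBelow F (p ++ Triple.toList (x, y, y') ++ q') := by
      simpa [Triple.toList] using hF
    simpa [Triple.toList, SkewInvolution.left, SkewInvolution.right] using
      hF'.confluent_overlap N hxy hxy'
  | _ :: _ :: t, h =>
    simp only [List.cons_append, List.cons.injEq] at h
    obtain ⟨rfl, rfl, rfl⟩ := h
    have hF' : R.RespectsStepsBelow F (p ++ [x, y] ++ (t ++ [x', y'] ++ q')) := by simpa using hF
    simpa using hF'.confluent_disjoint (step_pair hxy) (step_pair hxy')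

theorem RespectsStepsBelow.confluent [WellFoundedLT X] (hF : R.RespectsStepsBelow F w)
    (N : R.TermNormalForm) {c c' : G} {b b' : List X} (h : R.Step w c b) (h' : R.Step w c' b') :
    c • F b = c' • F b' := by
  obtain ⟨p, q, x, y, hxy, rfl, rfl, rfl⟩ := h
  obtain ⟨p', q', x', y', hxy', heq, rfl, rfl⟩ := h'
  rcases List.append_eq_append_iff.1 heq with ⟨t, rfl, ht⟩ | ⟨t, rfl, ht⟩
  · rw [List.append_assoc]
    exact hF.confluent_append N hxy hxy' ht
  · rw [heq] at hF
    rw [List.append_assoc]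
    exact (hF.confluent_append N hxy' hxy ht).symm

theorem TermNormalForm.exists_reduction [WellFoundedLT X] (N : R.TermNormalForm)
    (base : List X → M) : ∃ F : List X → M, (∀ a c b, R.Step a c b → F a = c • F b) ∧
      ∀ a, (∀ c b, ¬ R.Step a c b) → F a = base a :=
  exists_normalForm_of_locally_confluent (List.Shortlex.wf wellFounded_lt) Step.shortlex base
    fun _ _ hF _ _ _ _ => RespectsStepsBelow.confluent hF N

end Confluence

theorem reduction_apply_eq_zero {k X : Type*} [CommRing k] [LinearOrder X] [WellFoundedLT X]
    {R : MonomialInvolution kˣ X} {F : List X → (List X →₀ k)}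
    (step : ∀ a c b, R.Step a c b → F a = c • F b)
    (base : ∀ a, (∀ c b, ¬ R.Step a c b) → F a = Finsupp.single a 1) {u v : List X}
    (h : List.Shortlex (· < ·) v u) : F v u = 0 := by
  induction v using (List.Shortlex.wf (α := X) wellFounded_lt).induction with
  | _ v ih =>
    by_cases hv : ∃ c b, R.Step v c b
    · obtain ⟨c, b, hs⟩ := hv
      rw [step v c b hs, Finsupp.smul_apply, ih b hs.shortlex (trans_of _ hs.shortlex h), smul_zero]
    · rw [base v fun c b hs => hv ⟨c, b, hs⟩, Finsupp.single_eq_of_ne]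
      rintro rfl
      exact asymm_of (List.Shortlex (· < ·)) h h

end MonomialInvolution

/-! ### Words in the free algebra -/

section FreeWord

variable {k X : Type*} [CommRing k]

/-- The monomial of the free algebra given by a word. -/
noncomputable def freeWord (k : Type*) {X : Type*} [CommRing k] (l : List X) : FreeAlgebra k X :=
  (l.map (FreeAlgebra.ι k)).prod

theorem freeWord_append (l l' : List X) :
    freeWord k (l ++ l') = freeWord k l * freeWord k l' := by
  simp [freeWord]

/-- The basis of the free algebra that consists of the words. -/
noncomputable def freeWordBasis (k X : Type*) [CommRing k] :
    Module.Basis (List X) k (FreeAlgebra k X) :=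
  (FreeAlgebra.basisFreeMonoid k X).reindex FreeMonoid.toList

@[simp]
theorem freeWordBasis_apply (l : List X) : freeWordBasis k X l = freeWord k l := by
  simp [freeWordBasis, FreeAlgebra.basisFreeMonoid, freeWord,
    FreeAlgebra.equivMonoidAlgebraFreeMonoid, FreeMonoid.lift_apply]

@[simp]
theorem freeWordBasis_repr_freeWord (l : List X) :
    (freeWordBasis k X).repr (freeWord k l) = Finsupp.single l 1 := by
  rw [← freeWordBasis_apply, Module.Basis.repr_self]

theorem eq_zero_of_mem_span {M : Type*} [AddCommGroup M] [Module k M]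
    {F : Set (FreeAlgebra k X)} {Φ : FreeAlgebra k X →ₗ[k] M}
    (hΦ : ∀ g ∈ F, ∀ p q, Φ (freeWord k p * g * freeWord k q) = 0) {f : FreeAlgebra k X}
    (hf : f ∈ TwoSidedIdeal.span F) : Φ f = 0 := by
  have hmul : ∀ g ∈ F, ∀ a b, Φ (a * g * b) = 0 := by
    intro g hg a b
    let Ψ : FreeAlgebra k X →ₗ[k] FreeAlgebra k X →ₗ[k] M :=
      (LinearMap.mul k _ ∘ₗ LinearMap.mulRight k g).compr₂ Φ
    have hΨ : Ψ = 0 := (freeWordBasis k X).ext fun p => (freeWordBasis k X).ext fun q => by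
      simpa [Ψ] using hΦ g hg p q
    exact LinearMap.congr_fun₂ hΨ a b
  rw [TwoSidedIdeal.mem_span_iff_mem_addSubgroup_closure] at hf
  induction hf using AddSubgroup.closure_induction with
  | mem f hf =>
    obtain ⟨_, ⟨a, -, g, hg, rfl⟩, b, -, rfl⟩ := hf
    exact hmul g hg a b
  | zero => exact map_zero Φ
  | add f g _ _ hf hg => rw [map_add, hf, hg, add_zero]
  | neg f _ hf => rw [map_neg, hf, neg_zero]

end FreeWord

section LeadingWord

variable {k X : Type*} [Field k]

theorem mem_wordSupport_iff {f : FreeAlgebra k X} {w : List X} :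
    w ∈ wordSupport f ↔ (freeWordBasis k X).repr f w ≠ 0 := by
  rw [freeWordBasis, Module.Basis.repr_reindex_apply]
  rfl

variable [LinearOrder X] {f : FreeAlgebra k X} {u v : List X}

theorem exists_isLeadingWord (hf : f ≠ 0) : ∃ u, IsLeadingWord f u := by
  classical
  have : IsStrictTotalOrder (List X) (List.Shortlex (· < ·)) := { }
  let _ := linearOrderOfSTO (List.Shortlex (α := X) (· < ·))
  have hne : ((freeWordBasis k X).repr f).support.Nonempty := by simpa using hf
  obtain ⟨u, hu, hmax⟩ := Finset.exists_max_image _ id hne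
  refine ⟨u, mem_wordSupport_iff.2 (Finsupp.mem_support_iff.1 hu), fun v hv hvu => ?_⟩
  exact (hmax v (Finsupp.mem_support_iff.2 (mem_wordSupport_iff.1 hv))).lt_of_ne hvu

theorem IsLeadingWord.eq (hu : IsLeadingWord f u) (hv : IsLeadingWord f v) : u = v := by
  by_contra h
  exact asymm_of (List.Shortlex (· < ·)) (hv.2 u hu.1 h) (hu.2 v hv.1 (Ne.symm h))

theorem isLeadingWord_sub_smul (h : List.Shortlex (· < ·) v u) (c : k) :
    IsLeadingWord (freeWord k u - c • freeWord k v) u := by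
  have hne : u ≠ v := by
    rintro rfl
    exact asymm_of (List.Shortlex (· < ·)) h h
  refine ⟨mem_wordSupport_iff.2 ?_, fun w hw hwu => ?_⟩
  · simp [Finsupp.single_eq_of_ne hne]
  · by_cases hwv : w = v
    · rwa [hwv]
    · simp [mem_wordSupport_iff, Finsupp.single_eq_of_ne hwu, Finsupp.single_eq_of_ne hwv] at hw

theorem constr_apply_leadingWord {F : List X → (List X →₀ k)}
    (lower : ∀ v, List.Shortlex (· < ·) v u → F v u = 0) (hu : IsLeadingWord f u) :
    (freeWordBasis k X).constr k F f u = (freeWordBasis k X).repr f u * F u u := by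
  rw [Module.Basis.constr_apply, Finsupp.sum_apply, Finsupp.sum, Finset.sum_eq_single u]
  · rfl
  · intro v hv hvu
    rw [Finsupp.smul_apply, lower, smul_zero]
    exact hu.2 v (mem_wordSupport_iff.2 (Finsupp.mem_support_iff.1 hv)) hvu
  · intro hu'
    exact absurd (Finsupp.mem_support_iff.2 (mem_wordSupport_iff.1 hu.1)) hu'

end LeadingWord

/-! ### The relations as a monomial involution -/

namespace SkewPolynomialRelations

variable {k : Type*} [Field k] {n : ℕ} (S : SkewPolynomialRelations k n)

theorem pair_cases {P : Fin n × Fin n → Prop} (desc : ∀ p : DescPair n, P p.1)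
    (asc : ∀ p, P (S.rhs p)) (diag : ∀ x, P (x, x)) (q : Fin n × Fin n) : P q := by
  obtain ⟨x, y⟩ := q
  rcases lt_trichotomy x y with h | rfl | h
  · rw [← S.rhs_lhs h]
    exact asc _
  · exact diag _
  · exact desc ⟨(x, y), h⟩

/-- The permutation of the words of length two underlying `R(ℜ₀)`. -/
noncomputable def pairMap (q : Fin n × Fin n) : Fin n × Fin n :=
  if h : q.2 < q.1 then S.rhs ⟨q, h⟩ else if h' : q.1 < q.2 then (S.lhs h').1 else q

/-- The scalars in the definition of `R(ℜ₀)`. -/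
noncomputable def pairCoeff (q : Fin n × Fin n) : kˣ :=
  if h : q.2 < q.1 then .mk0 _ (S.coeff_ne_zero ⟨q, h⟩)
  else if h' : q.1 < q.2 then (.mk0 _ (S.coeff_ne_zero (S.lhs h')))⁻¹
  else 1

theorem pairMap_desc (p : DescPair n) : S.pairMap p.1 = S.rhs p := dif_pos p.2

theorem pairMap_asc (p : DescPair n) : S.pairMap (S.rhs p) = p.1 := by
  rw [pairMap, dif_neg (S.rhs_lt p).not_gt, dif_pos (S.rhs_lt p), S.lhs_eq _ p rfl]

theorem pairMap_diag (x : Fin n) : S.pairMap (x, x) = (x, x) := by simp [pairMap]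

theorem pairCoeff_desc (p : DescPair n) : S.pairCoeff p.1 = .mk0 _ (S.coeff_ne_zero p) :=
  dif_pos p.2

theorem pairCoeff_asc (p : DescPair n) :
    S.pairCoeff (S.rhs p) = (.mk0 _ (S.coeff_ne_zero p))⁻¹ := by
  simp only [pairCoeff, dif_neg (S.rhs_lt p).not_gt, dif_pos (S.rhs_lt p), S.lhs_eq _ p rfl]

theorem pairCoeff_diag (x : Fin n) : S.pairCoeff (x, x) = 1 := by simp [pairCoeff]

/-- The monomial involution `R(ℜ₀)`. -/
noncomputable def monomialInvolution : MonomialInvolution kˣ (Fin n) where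
  map := S.pairMap
  map_map := S.pair_cases (fun p => by rw [pairMap_desc, pairMap_asc])
    (fun p => by rw [pairMap_asc, pairMap_desc]) fun x => by rw [pairMap_diag, pairMap_diag]
  map_diag := S.pairMap_diag
  map_fst_lt_snd {q} h := by
    rw [S.pairMap_desc ⟨q, h⟩]
    exact S.rhs_lt _
  map_snd_lt_fst {q} h := by
    obtain ⟨p, hp⟩ := S.exists_rhs_eq h
    rw [← Prod.mk.eta (p := q), ← hp, pairMap_asc]
    exact p.2
  map_fst_lt {q} h := by
    rw [S.pairMap_desc ⟨q, h⟩]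
    exact S.rhs_fst_lt ⟨q, h⟩
  coeff := S.pairCoeff
  coeff_map := S.pair_cases (fun p => by rw [pairMap_desc, pairCoeff_asc, pairCoeff_desc])
    (fun p => by rw [pairMap_asc, pairCoeff_asc, pairCoeff_desc, inv_inv])
    fun x => by rw [pairMap_diag, pairCoeff_diag, inv_one]
  coeff_diag := S.pairCoeff_diag

theorem monomialInvolution_map (p : DescPair n) : S.monomialInvolution.map p.1 = S.rhs p :=
  S.pairMap_desc p

theorem coe_monomialInvolution_coeff (p : DescPair n) :
    (S.monomialInvolution.coeff p.1 : k) = S.coeff p := by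
  rw [show S.monomialInvolution.coeff p.1 = _ from S.pairCoeff_desc p, Units.val_mk0]

end SkewPolynomialRelations

/-! ### Normal forms and Gröbner bases -/

section UnitsSMul

variable {k A : Type*} [CommSemiring k] [Ring A] [Algebra k A] {I : TwoSidedIdeal A} {f g h : A}
  {c d : kˣ}

theorem units_smul_mem_ideal (hf : f ∈ I) (c : kˣ) : c • f ∈ I := by
  rw [Units.smul_def, Algebra.smul_def]
  exact I.mul_mem_left _ _ hf

theorem sub_units_smul_mem_ideal_trans (hfg : f - c • g ∈ I) (hgh : g - d • h ∈ I) :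
    f - (c * d) • h ∈ I := by
  have := I.add_mem hfg (units_smul_mem_ideal hgh c)
  rwa [smul_sub, smul_smul, sub_add_sub_cancel] at this

theorem sub_units_smul_mem_ideal_symm (h : f - c • g ∈ I) : g - c⁻¹ • f ∈ I := by
  have := I.neg_mem (units_smul_mem_ideal h c⁻¹)
  rwa [smul_sub, inv_smul_smul, neg_sub] at this

end UnitsSMul

namespace SkewPolynomialRelations

open Triple

variable {k : Type*} [Field k] {n : ℕ} (S : SkewPolynomialRelations k n)

theorem relation_eq (p : DescPair n) : S.relation p
    = freeWord k [p.1.1, p.1.2] - S.coeff p • freeWord k [(S.rhs p).1, (S.rhs p).2] := by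
  simp [relation, freeWord]

theorem relation_mem_ideal (p : DescPair n) : S.relation p ∈ S.ideal :=
  TwoSidedIdeal.subset_span ⟨p, rfl⟩

theorem isLeadingWord_relation (p : DescPair n) :
    IsLeadingWord (S.relation p) [p.1.1, p.1.2] := by
  rw [relation_eq]
  exact isLeadingWord_sub_smul (shortlex_append_cons_cons [] [] (S.rhs_fst_lt p) _ _) _

theorem step_relation (p : DescPair n) : S.monomialInvolution.Step [p.1.1, p.1.2]
    (S.monomialInvolution.coeff p.1) [(S.rhs p).1, (S.rhs p).2] := by
  rw [← S.monomialInvolution_map]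
  exact MonomialInvolution.step_pair p.2

theorem constr_eq_zero_of_mem_ideal {M : Type*} [AddCommGroup M] [Module k M] {F : List (Fin n) → M}
    (step : ∀ a c b, S.monomialInvolution.Step a c b → F a = c • F b)
    {f : FreeAlgebra k (Fin n)} (hf : f ∈ S.ideal) :
    (freeWordBasis k (Fin n)).constr k F f = 0 := by
  have apply_word : ∀ l, (freeWordBasis k (Fin n)).constr k F (freeWord k l) = F l := fun l => by
    rw [← freeWordBasis_apply, Module.Basis.constr_basis]
  refine eq_zero_of_mem_span ?_ hf
  rintro _ ⟨p, rfl⟩ l l'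
  rw [relation_eq, mul_sub, sub_mul, mul_smul_comm, smul_mul_assoc, ← freeWord_append,
    ← freeWord_append, ← freeWord_append, ← freeWord_append, map_sub, map_smul, apply_word,
    apply_word, step _ _ _ ((S.step_relation p).append l l'), Units.smul_def,
    coe_monomialInvolution_coeff, sub_self]

/-- A leading word without a descent would be left unchanged by the reduction, which however kills
the ideal. -/
theorem isGroebnerBasis_of_termNormalForm (N : S.monomialInvolution.TermNormalForm) :
    IsGroebnerBasis S.relations S.ideal := by
  obtain ⟨F, step, base⟩ := N.exists_reduction fun l => Finsupp.single l (1 : k)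
  refine ⟨fun g hg => TwoSidedIdeal.subset_span hg, fun f hf hf0 => ?_⟩
  obtain ⟨u, hu⟩ := exists_isLeadingWord hf0
  refine ⟨u, hu, ?_⟩
  by_cases hdesc : ∃ c b, S.monomialInvolution.Step u c b
  · obtain ⟨_, _, p, q, x, y, hxy, rfl, -, -⟩ := hdesc
    exact ⟨_, ⟨⟨(x, y), hxy⟩, rfl⟩, _, S.isLeadingWord_relation _, p, q, by simp⟩
  · have hcoeff := constr_apply_leadingWord
      (fun v hv => MonomialInvolution.reduction_apply_eq_zero step base hv) hu
    rw [S.constr_eq_zero_of_mem_ideal step hf, base u fun c b h => hdesc ⟨c, b, h⟩,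
      Finsupp.single_eq_same, mul_one] at hcoeff
    exact absurd hcoeff.symm (mem_wordSupport_iff.1 hu.1)

theorem freeWord_sub_map_mem (q : Fin n × Fin n) : freeWord k [q.1, q.2]
    - S.monomialInvolution.coeff q • freeWord k
      [(S.monomialInvolution.map q).1, (S.monomialInvolution.map q).2] ∈ S.ideal := by
  have desc : ∀ p : DescPair n, freeWord k [p.1.1, p.1.2]
      - S.monomialInvolution.coeff p.1 • freeWord k [(S.rhs p).1, (S.rhs p).2] ∈ S.ideal :=
    fun p => by
      rw [Units.smul_def, coe_monomialInvolution_coeff, ← relation_eq]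
      exact S.relation_mem_ideal p
  induction q using S.pair_cases with
  | desc p =>
    rw [monomialInvolution_map]
    exact desc p
  | asc p =>
    rw [← monomialInvolution_map, S.monomialInvolution.map_map, S.monomialInvolution.coeff_map,
      monomialInvolution_map]
    exact sub_units_smul_mem_ideal_symm (desc p)
  | diag x =>
    rw [S.monomialInvolution.map_diag, S.monomialInvolution.coeff_diag, one_smul, sub_self]
    exact S.ideal.zero_mem

theorem freeWord_sub_left_mem (w : Triple (Fin n)) :
    freeWord k w.toList - S.monomialInvolution.coeff (w.1, w.2.1) •
      freeWord k (S.monomialInvolution.left w).toList ∈ S.ideal := by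
  have := S.ideal.mul_mem_right _ (freeWord k [w.2.2]) (S.freeWord_sub_map_mem (w.1, w.2.1))
  rwa [sub_mul, smul_mul_assoc, ← freeWord_append, ← freeWord_append] at this

theorem freeWord_sub_right_mem (w : Triple (Fin n)) :
    freeWord k w.toList - S.monomialInvolution.coeff w.2 •
      freeWord k (S.monomialInvolution.right w).toList ∈ S.ideal := by
  have := S.ideal.mul_mem_left (freeWord k [w.1]) _ (S.freeWord_sub_map_mem w.2)
  rwa [mul_sub, mul_smul_comm, ← freeWord_append, ← freeWord_append] at this

theorem exists_normal_sub_mem (w : Triple (Fin n)) : ∃ (u : Triple (Fin n)) (c : kˣ),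
    u.IsNormal ∧ freeWord k w.toList - c • freeWord k u.toList ∈ S.ideal := by
  induction w using S.monomialInvolution.triple_induction with
  | normal w hw =>
    refine ⟨w, 1, hw, ?_⟩
    rw [one_smul, sub_self]
    exact S.ideal.zero_mem
  | left w _ ih =>
    obtain ⟨u, c, hu, hc⟩ := ih
    exact ⟨u, _, hu, sub_units_smul_mem_ideal_trans (S.freeWord_sub_left_mem w) hc⟩
  | right w _ ih =>
    obtain ⟨u, c, hu, hc⟩ := ih
    exact ⟨u, _, hu, sub_units_smul_mem_ideal_trans (S.freeWord_sub_right_mem w) hc⟩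

variable {S}

theorem eq_zero_of_mem_ideal_of_sorted (hG : IsGroebnerBasis S.relations S.ideal)
    {f : FreeAlgebra k (Fin n)} (hf : f ∈ S.ideal)
    (hsorted : ∀ l ∈ wordSupport f, l.Pairwise (· ≤ ·)) : f = 0 := by
  by_contra hf0
  obtain ⟨l, hl, _, ⟨p, rfl⟩, v, hv, hvl⟩ := hG.2 f hf hf0
  rw [hv.eq (S.isLeadingWord_relation p)] at hvl
  exact (List.pairwise_pair.1 ((hsorted l hl.1).sublist hvl.sublist)).not_gt p.2

theorem eq_of_isNormal_of_sub_mem_ideal (hG : IsGroebnerBasis S.relations S.ideal)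
    {u v : Triple (Fin n)} {c d : kˣ} (hu : u.IsNormal) (hv : v.IsNormal)
    (h : c • freeWord k u.toList - d • freeWord k v.toList ∈ S.ideal) : u = v ∧ c = d := by
  have repr_sub : (freeWordBasis k (Fin n)).repr
      (c • freeWord k u.toList - d • freeWord k v.toList)
        = Finsupp.single u.toList (c : k) - Finsupp.single v.toList (d : k) := by
    simp [Units.smul_def]
  have hzero := eq_zero_of_mem_ideal_of_sorted hG h fun l hl => by
    rw [mem_wordSupport_iff, repr_sub] at hl
    by_cases hlu : l = u.toList
    · exact hlu ▸ hu.pairwise_toList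
    by_cases hlv : l = v.toList
    · exact hlv ▸ hv.pairwise_toList
    simp [Finsupp.single_eq_of_ne hlu, Finsupp.single_eq_of_ne hlv] at hl
  rw [hzero, map_zero, eq_comm, sub_eq_zero] at repr_sub
  rcases (Finsupp.single_eq_single_iff _ _ _ _).1 repr_sub with ⟨huv, hcd⟩ | ⟨hc, -⟩
  · exact ⟨toList_injective huv, Units.ext hcd⟩
  · exact absurd hc c.ne_zero

theorem nonempty_termNormalForm_of_isGroebnerBasis
    (hG : IsGroebnerBasis S.relations S.ideal) : Nonempty S.monomialInvolution.TermNormalForm := by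
  choose nf scalar isNormal_nf hmem using S.exists_normal_sub_mem
  have unique : ∀ {w u : Triple (Fin n)} {c : kˣ}, u.IsNormal →
      freeWord k w.toList - c • freeWord k u.toList ∈ S.ideal → nf w = u ∧ scalar w = c :=
    fun {w u c} hu h => eq_of_isNormal_of_sub_mem_ideal hG (isNormal_nf w) hu (by
      have := S.ideal.sub_mem h (hmem w)
      rwa [sub_sub_sub_cancel_left] at this)
  have normal : ∀ {w : Triple (Fin n)}, w.IsNormal → nf w = w ∧ scalar w = 1 := fun hw =>
    unique hw (by
      rw [one_smul, sub_self]
      exact S.ideal.zero_mem)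
  have left := fun w => unique (isNormal_nf _)
    (sub_units_smul_mem_ideal_trans (S.freeWord_sub_left_mem w) (hmem _))
  have right := fun w => unique (isNormal_nf _)
    (sub_units_smul_mem_ideal_trans (S.freeWord_sub_right_mem w) (hmem _))
  exact ⟨{
    nf := nf
    nf_left := fun w => (left w).1.symm
    nf_right := fun w => (right w).1.symm
    isNormal_nf := isNormal_nf
    nf_eq_self := fun hw => (normal hw).1
    scalar := scalar
    scalar_eq_one := fun hw => (normal hw).2
    scalar_left := fun w => (left w).2
    scalar_right := fun w => (right w).2 }⟩

variable (S) in
theorem isGroebnerBasis_iff_nonempty_termNormalForm : IsGroebnerBasis S.relations S.ideal ↔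
    Nonempty S.monomialInvolution.TermNormalForm :=
  ⟨nonempty_termNormalForm_of_isGroebnerBasis, fun ⟨N⟩ => S.isGroebnerBasis_of_termNormalForm N⟩

end SkewPolynomialRelations

/-! ### The Yang-Baxter equation on basis vectors -/

namespace SkewPolynomialRelations

variable {k : Type*} [Field k] {n : ℕ} (S : SkewPolynomialRelations k n)
  {V : Type*} [AddCommGroup V] [Module k V] (b : Module.Basis (Fin n) k V)

theorem automorphism_tmul (q : Fin n × Fin n) :
    S.automorphism b (b q.1 ⊗ₜ[k] b q.2) = S.monomialInvolution.coeff q •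
      (b (S.monomialInvolution.map q).1 ⊗ₜ[k] b (S.monomialInvolution.map q).2) := by
  change S.autoMap b _ = _
  induction q using S.pair_cases with
  | desc p =>
    rw [autoMap_desc, monomialInvolution_map, Units.smul_def, coe_monomialInvolution_coeff]
  | asc p =>
    rw [autoMap_asc, ← monomialInvolution_map, S.monomialInvolution.map_map,
      S.monomialInvolution.coeff_map, Units.smul_def, Units.val_inv_eq_inv_val,
      coe_monomialInvolution_coeff]
  | diag x =>
    rw [autoMap_diag, S.monomialInvolution.map_diag, S.monomialInvolution.coeff_diag, one_smul]

end SkewPolynomialRelations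

section TripleBasis

variable {ι k V : Type*} [CommRing k] [AddCommGroup V] [Module k V] (b : Module.Basis ι k V)

/-- The basis `x ⊗ y ⊗ z` of `V ⊗ V ⊗ V`, indexed by words of length three. -/
noncomputable def tripleBasis : Module.Basis (Triple ι) k ((V ⊗[k] V) ⊗[k] V) :=
  ((b.tensorProduct b).tensorProduct b).reindex (Equiv.prodAssoc _ _ _)

theorem tripleBasis_apply (w : Triple ι) :
    tripleBasis b w = b w.1 ⊗ₜ[k] b w.2.1 ⊗ₜ[k] b w.2.2 := by
  simp [tripleBasis, Module.Basis.tensorProduct_apply]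

/-- The vector in `V ⊗ V ⊗ V` denoted by a scalar multiple of a word of length three. -/
noncomputable def termVector (p : kˣ × Triple ι) : (V ⊗[k] V) ⊗[k] V := p.1 • tripleBasis b p.2

theorem termVector_injective [Nontrivial k] : Function.Injective (termVector b) := by
  rintro ⟨c, w⟩ ⟨d, v⟩ h
  have hrepr := congrArg (tripleBasis b).repr h
  simp only [termVector, Units.smul_def, map_smul, Module.Basis.repr_self, Finsupp.smul_single,
    smul_eq_mul, mul_one] at hrepr
  rcases (Finsupp.single_eq_single_iff _ _ _ _).1 hrepr with ⟨hwv, hcd⟩ | ⟨hc, -⟩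
  · exact Prod.ext (Units.ext hcd) hwv
  · exact absurd hc c.ne_zero

end TripleBasis

namespace SkewPolynomialRelations

variable {k : Type*} [Field k] {n : ℕ} (S : SkewPolynomialRelations k n)
  {V : Type*} [AddCommGroup V] [Module k V] (b : Module.Basis (Fin n) k V)

theorem actLeft_termVector (p : kˣ × Triple (Fin n)) :
    actLeft (S.automorphism b) (termVector b p)
      = termVector b (S.monomialInvolution.termLeft p) := by
  obtain ⟨c, w⟩ := p
  have hw : actLeft (S.automorphism b) (tripleBasis b w) =
      S.monomialInvolution.coeff (w.1, w.2.1) • tripleBasis b (S.monomialInvolution.left w) := by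
    rw [tripleBasis_apply, tripleBasis_apply, actLeft, TensorProduct.congr_tmul,
      S.automorphism_tmul b (w.1, w.2.1), LinearEquiv.refl_apply, Units.smul_def,
      TensorProduct.smul_tmul', Units.smul_def]
    rfl
  simp only [termVector, MonomialInvolution.termLeft, Units.smul_def, map_smul, hw, smul_smul,
    Units.val_mul]

theorem actRight_termVector (p : kˣ × Triple (Fin n)) :
    actRight (S.automorphism b) (termVector b p)
      = termVector b (S.monomialInvolution.termRight p) := by
  obtain ⟨c, w⟩ := p
  have hw : actRight (S.automorphism b) (tripleBasis b w) =
      S.monomialInvolution.coeff w.2 • tripleBasis b (S.monomialInvolution.right w) := by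
    rw [tripleBasis_apply, tripleBasis_apply, actRight, LinearEquiv.trans_apply,
      LinearEquiv.trans_apply, TensorProduct.assoc_tmul, TensorProduct.congr_tmul,
      S.automorphism_tmul b w.2, LinearEquiv.refl_apply, Units.smul_def, TensorProduct.tmul_smul,
      map_smul, TensorProduct.assoc_symm_tmul, Units.smul_def]
    rfl
  simp only [termVector, MonomialInvolution.termRight, Units.smul_def, map_smul, hw, smul_smul,
    Units.val_mul]

theorem isYangBaxterSolution_iff_isBraided :
    IsYangBaxterSolution (S.automorphism b) ↔ S.monomialInvolution.IsBraided := by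
  constructor
  · intro h p
    have hp := LinearEquiv.congr_fun h (termVector b p)
    simp only [LinearEquiv.mul_apply, actLeft_termVector, actRight_termVector] at hp
    exact termVector_injective b hp
  · intro h
    refine LinearEquiv.toLinearMap_injective ((tripleBasis b).ext fun w => ?_)
    have hw : tripleBasis b w = termVector b (1, w) := (one_smul _ _).symm
    simp only [LinearEquiv.coe_coe, LinearEquiv.mul_apply, hw, actLeft_termVector,
      actRight_termVector, h (1, w)]

end SkewPolynomialRelations

theorem mainTheorem9 {k : Type*} [Field k] {n : ℕ} {V : Type*} [AddCommGroup V] [Module k V]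
    (x : Module.Basis (Fin n) k V) (S : SkewPolynomialRelations k n) :
    IsYangBaxterSolution (S.automorphism x) ↔ IsGroebnerBasis S.relations S.ideal :=
  calc IsYangBaxterSolution (S.automorphism x)
    _ ↔ S.monomialInvolution.IsBraided := S.isYangBaxterSolution_iff_isBraided x
    _ ↔ Nonempty S.monomialInvolution.TermNormalForm :=
      S.monomialInvolution.isBraided_iff_nonempty_termNormalForm
    _ ↔ IsGroebnerBasis S.relations S.ideal :=
      S.isGroebnerBasis_iff_nonempty_termNormalForm.symm
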